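/- **Setting.** Let $d\ge 2$, let $\Omega\subseteq[0,1]^d$ be measurable with positive Lebesgue measure, and let $\mathcal P_X$ be the uniform distribution on $\Omega$. Let $Z$ be a random function on $\Omega$ (jointly measurable, $Z(x)$ integrable for each $x \in \Omega$) with mean function $f^\circ(x)=\mathbb E[Z(x)]$, and put $U=Z-f^\circ$. In the repeated-measurements model one observes $(X_{ij},Y_{ij})$, $1\le i\le n$, $1\le j\le m$, $$Y_{ij}=Z_i(X_{ij})+\epsilon_{ij}=f^\circ(X_{ij})+U_i(X_{ij})+\epsilon_{ij},$$ where $Z_1,\dots,Z_n$ are i.i.d. copies of $Z$, the $X_{ij}$ are i.i.d. with law $\mathcal P_X$, the noise variables $\epsilon_{ij}$ are independent with mean zero, and the three families $(Z_i)$, $(X_{ij})$, $(\epsilon_{ij})$ are independent. For $\boldsymbol s=(s_1,\dots,s_d)$ with all $s_i>0$, let $\lfloor s_i\rfloor$ denote the largest integer strictly smaller than $s_i$. The anisotropic $\boldsymbol s$-Hölder norm of $f:\Omega\to\mathbb R$ is $$\|f\|_{\mathcal C^{\boldsymbol s}}=\sum_{i=1}^d\ \sum_{0\le\alpha<s_i}\|\partial_i^\alpha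 f\|_\infty+\sum_{i=1}^d\ \sup_{\substack{x,x'\in\Omega\\ x'=x+te_i,\ t\ne0}}\frac{|\partial_i^{\lfloor s_i\rfloor}f(x)-\partial_i^{\lfloor s_i\rfloor}f(x')|}{|t|^{s_i-\lfloor s_i\rfloor}},$$ where $\partial_i^\alpha$ is the partial derivative of order $\alpha$ in the $i$-th coordinate, taken within $\Omega$ along the coordinate line (where these derivatives are not unique, the norm is the infimum over all admissible choices), and $\|f\|_{\mathcal C^{\boldsymbol s}}=\infty$ if one of them does not exist. Let $\tilde s=d/(s_1^{-1}+\dots+s_d^{-1})$. Fix $B>0$, $b_2>0$, $b_3\ge0$, and let $\mathcal Q_{Z,\epsilon}$ be the set of all distributions of $(Z,\epsilon)$ as above such that $U$ has continuous paths on $\Omega$, $$\mathbb E\exp\left(|U(X)|/b_2\right)\le2,\qquad \mathbb E\exp\left(|\epsilon_{ij}|/b_3\right)\le2\quad(1\le i\le n,\ 1\le j\le m)$$ with $X\sim\mathcal P_X$ independent of $Z$ (for $b_3=0$ the second condition means $\epsilon_{ij}=0$ almost surely), and $\|f^\circ\|_{\mathcal C^{\boldsymbol s}}\le B$. **Theorem.**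 There is a constant $c>0$, not depending on $n$ and $m$, such that for all integers $n,m\ge1$ $$\inf_{\tilde f}\ \sup_{\mathcal Q_{Z,\epsilon}}\ \mathbb E\left[\int_\Omega(\tilde f(x)-f^\circ(x))^2\,d\mathcal P_X(x)\right]\ \ge\ c\left(n^{-1}+(nm)^{-2\tilde s/(2\tilde s+d)}\right),$$ where the infimum is over all (jointly measurable) estimators $\tilde f$ based on the data $\{(Y_{ij},X_{ij}):1\le i\le n,\ 1\le j\le m\}$. -/

import Mathlib

open MeasureTheory
open scoped ENNReal

noncomputable section

/-! ### Anisotropic Hölder norm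

For `s > 0` the largest integer strictly smaller than `s` is `⌈s⌉₊ - 1`, and the natural numbers
strictly smaller than `s` are exactly the elements of `Finset.range ⌈s⌉₊`. -/

/-- `g i k` is, on `D`, a `k`-th order partial derivative of `f` in the `i`-th coordinate, for all
orders `k < s i`. Derivatives are taken along the part of the coordinate line lying in `D` (so they
are one-sided at end points); whenever these parts have no isolated points, the values of `g i k`
on `D`, `k < s i`, are determined by `f`. -/
structure IsPartialDerivFamily {d : ℕ} (D : Set (Fin d → ℝ)) (s : Fin d → ℝ)
    (f : (Fin d → ℝ) → ℝ) (g : Fin d → ℕ → (Fin d → ℝ) → ℝ) : Prop where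
  zero : ∀ i, ∀ x ∈ D, g i 0 x = f x
  succ : ∀ i (k : ℕ), ((k + 1 : ℕ) : ℝ) < s i → ∀ x ∈ D,
    HasDerivWithinAt (fun t : ℝ => g i k (x + Pi.single i t)) (g i (k + 1) x)
      {t : ℝ | x + Pi.single i t ∈ D} 0

/-- `‖h‖_∞ = sup_{x ∈ D} |h x|`. -/
def supNormOn {d : ℕ} (D : Set (Fin d → ℝ)) (h : (Fin d → ℝ) → ℝ) : ℝ≥0∞ :=
  ⨆ x ∈ D, ENNReal.ofReal |h x|

/-- The `γ`-Hölder seminorm on `D` in the `i`-th coordinate: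
`sup |h x - h x'| / ‖x - x'‖ ^ γ` over `x, x' ∈ D` with `x' = x + t e_i`, `t ≠ 0`. -/
def coordHolderSeminorm {d : ℕ} (D : Set (Fin d → ℝ)) (i : Fin d) (γ : ℝ)
    (h : (Fin d → ℝ) → ℝ) : ℝ≥0∞ :=
  ⨆ x ∈ D, ⨆ (t : ℝ) (_ : t ≠ 0) (_ : x + Pi.single i t ∈ D),
    ENNReal.ofReal (|h x - h (x + Pi.single i t)| / |t| ^ γ)

/-- The anisotropic `s`-Hölder norm of `f` on `D`; it is `∞` if a partial derivative `∂_i^k f`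
with `k < s i` does not exist. -/
def anisoHolderNorm {d : ℕ} (D : Set (Fin d → ℝ)) (s : Fin d → ℝ)
    (f : (Fin d → ℝ) → ℝ) : ℝ≥0∞ :=
  ⨅ (g : Fin d → ℕ → (Fin d → ℝ) → ℝ) (_ : IsPartialDerivFamily D s f g),
    (∑ i, ∑ k ∈ Finset.range ⌈s i⌉₊, supNormOn D (g i k)) +
      ∑ i, coordHolderSeminorm D i (s i - ((⌈s i⌉₊ - 1 : ℕ) : ℝ)) (g i (⌈s i⌉₊ - 1))

/-- The harmonic mean `d / (s₁⁻¹ + ⋯ + s_d⁻¹)`. -/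
def harmonicMean {d : ℕ} (s : Fin d → ℝ) : ℝ := d / ∑ i, (s i)⁻¹

/-! ### The repeated measurements model -/

/-- The uniform distribution on `D`. -/
def uniformLaw {d : ℕ} (D : Set (Fin d → ℝ)) : Measure (Fin d → ℝ) :=
  (volume D)⁻¹ • volume.restrict D

/-- The real random variable `Y` is sub-exponential with parameter `b ≥ 0`:
`E exp (|Y| / b) ≤ 2`, which for `b = 0` is read as `Y = 0` almost surely. -/
def IsSubExponential {S : Type*} [MeasurableSpace S] (μ : Measure S) (Y : S → ℝ) (b : ℝ) : Prop :=
  (b = 0 → ∀ᵐ ω ∂μ, Y ω = 0) ∧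
    (b ≠ 0 → ∫⁻ ω, ENNReal.ofReal (Real.exp (|Y ω| / b)) ∂μ ≤ 2)

/-- A distribution of the random function `Z` on `D` (given through a probability space carrying
`Z`) together with the distributions of the centred noise variables `ε_ij`. -/
structure RandomFunctionAndNoise (d n m : ℕ) (D : Set (Fin d → ℝ)) where
  S : Type
  [measurableSpaceS : MeasurableSpace S]
  P : Measure S
  isProbability_P : IsProbabilityMeasure P
  Z : S → (Fin d → ℝ) → ℝ
  measurable_Z : Measurable fun p : S × D => Z p.1 p.2
  integrable_Z : ∀ x ∈ D, Integrable (fun ω => Z ω x) P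
  noise : Fin n → Fin m → Measure ℝ
  isProbability_noise : ∀ i j, IsProbabilityMeasure (noise i j)
  integrable_noise : ∀ i j, Integrable (fun e : ℝ => e) (noise i j)
  mean_noise : ∀ i j, ∫ e : ℝ, e ∂(noise i j) = 0

attribute [instance] RandomFunctionAndNoise.measurableSpaceS

namespace RandomFunctionAndNoise

variable {d n m : ℕ} {D : Set (Fin d → ℝ)}

/-- The regression (mean) function `f°(x) = E Z(x)`. -/
def regressionFunction (M : RandomFunctionAndNoise d n m D) (x : Fin d → ℝ) : ℝ :=
  ∫ ω, M.Z ω x ∂M.P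

/-- The individual stochastic part `U = Z - f°`. -/
def U (M : RandomFunctionAndNoise d n m D) (ω : M.S) (x : Fin d → ℝ) : ℝ :=
  M.Z ω x - M.regressionFunction x

/-- The joint law of `((Z_i)_i, (X_ij)_ij, (ε_ij)_ij)`: `Z_1, …, Z_n` are i.i.d. copies of `Z`, the
`X_ij` are i.i.d. with law `PX`, the `ε_ij` are independent, and the three families are
independent. -/
def jointLaw (M : RandomFunctionAndNoise d n m D) (PX : Measure (Fin d → ℝ)) :
    Measure ((Fin n → M.S) × (Fin n → Fin m → Fin d → ℝ) × (Fin n → Fin m → ℝ)) :=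
  (Measure.pi fun _ => M.P).prod
    ((Measure.pi fun _ => Measure.pi fun _ => PX).prod
      (Measure.pi fun i => Measure.pi fun j => M.noise i j))

/-- The data `(X_ij, Y_ij)` with `Y_ij = Z_i(X_ij) + ε_ij`. -/
def data (M : RandomFunctionAndNoise d n m D)
    (q : (Fin n → M.S) × (Fin n → Fin m → Fin d → ℝ) × (Fin n → Fin m → ℝ)) :
    Fin n → Fin m → (Fin d → ℝ) × ℝ :=
  fun i j => (q.2.1 i j, M.Z (q.1 i) (q.2.1 i j) + q.2.2 i j)

/-- The mean squared prediction error `E ∫ (f̃(x) - f°(x))² dPX(x)` of an estimator `f̃`. -/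
def predictionError (M : RandomFunctionAndNoise d n m D) (PX : Measure (Fin d → ℝ))
    (est : (Fin n → Fin m → (Fin d → ℝ) × ℝ) → (Fin d → ℝ) → ℝ) : ℝ≥0∞ :=
  ∫⁻ q, ∫⁻ x, ENNReal.ofReal ((est (M.data q) x - M.regressionFunction x) ^ 2) ∂PX
    ∂(M.jointLaw PX)

/-- The process `U` is continuous, `U(X)` is sub-exponential with parameter `b₂`, where `X ∼ PX` is
independent of `Z`, and each `ε_ij` is sub-exponential with parameter `b₃`. -/
structure RegularProcessAndNoise (M : RandomFunctionAndNoise d n m D)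
    (PX : Measure (Fin d → ℝ)) (b₂ b₃ : ℝ) : Prop where
  continuous_U : ∀ ω, ContinuousOn (M.U ω) D
  subexp_U : IsSubExponential (M.P.prod PX) (fun p => M.U p.1 p.2) b₂
  subexp_noise : ∀ i j, IsSubExponential (M.noise i j) (fun e => e) b₃

end RandomFunctionAndNoise

/-- The minimax prediction error over the anisotropic Hölder class: the infimum is over all
(measurable) estimators based on the data, the supremum is over all distributions of `Z` and the
noise for which the process and noise are regular with parameters `b₂, b₃` and the regression
function has anisotropic `s`-Hölder norm at most `B`. -/
def minimaxPredictionError {d : ℕ} (n m : ℕ) (D : Set (Fin d → ℝ)) (PX : Measure (Fin d → ℝ))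
    (s : Fin d → ℝ) (B b₂ b₃ : ℝ) : ℝ≥0∞ :=
  ⨅ (est : (Fin n → Fin m → (Fin d → ℝ) × ℝ) → (Fin d → ℝ) → ℝ)
    (_ : Measurable (Function.uncurry est)),
    ⨆ (M : RandomFunctionAndNoise d n m D) (_ : M.RegularProcessAndNoise PX b₂ b₃)
      (_ : anisoHolderNorm D s M.regressionFunction ≤ ENNReal.ofReal B),
      M.predictionError PX est

end

/-! The hard instances are noiseless: the randomness of the curves alone causes the error, so `b₃ =
0` is covered. Take `Z = A ∑ ξ_k φ_k` with bumps `φ_k` of disjoint supports, fixed amplitude `A = b₂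
/ 4` and independent random signs `ξ_k` of mean `ε v_k`, `v_k = ±1`. Then `f° = A ε ∑ v_k φ_k`, and
estimating `f°` amounts to recovering `v`. Only `f°` has to be Hölder; the paths of `Z` need only be
continuous and bounded, so they may oscillate with amplitude `A` on any grid.

Given the design, curve `i` tells something about `v_k` only if some `X_ij` hits the support of
`φ_k`, and however many points hit, it yields one coin of bias `±ε`. If `r_k` curves hit, the
squared Hellinger affinity of the hypotheses `v_k = ±1` is `(1 - ε²)^{r_k} ≥ 1 - r_k ε²`. Averaging
over `v` as in Assouad's lemma (`exists_le_predictionError_signModel`) gives a risk of order `(A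
ε)²` as soon as `ε² E r_k ≤ 1/2`.

Two bounds on `r_k` give the two rates. From `r_k ≤ n`, the single function `φ = 1` and `ε ≍
n^{-1/2}` one gets `n^{-1}` (`exists_parametric_lower_bound`). From `E r_k ≤ n m P_X(supp φ_k)` and
a grid with about `ρ^{-1/s_i}` cells in direction `i`, `ε ≍ ρ`, one gets `ρ²`
(`exists_nonparametric_lower_bound`): `f°` stays in the Hölder ball, a cell has mass at most of
order `ρ^S` with `S = ∑ 1/s_i`, and `n m ρ^{S+2} = 1` is the balance. -/

/-! ### Two-point testing bound for products of coins. -/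

/-- A sum over a product of two-point probability spaces does not change if factors on which the
summand does not depend are replaced by other probability vectors. -/
theorem sum_prod_mul_congr_of_invariant {ι : Type*} [Fintype ι] [DecidableEq ι]
    (p p' : ι → Bool → ℝ) (hp : ∀ l, p l true + p l false = 1)
    (hp' : ∀ l, p' l true + p' l false = 1) (J : Finset ι) (F : (ι → Bool) → ℝ)
    (hF : ∀ l ∈ J, ∀ ω b, F (Function.update ω l b) = F ω) (hpp : ∀ l, l ∉ J → p l = p' l) :
    ∑ ω, (∏ l, p l (ω l)) * F ω = ∑ ω, (∏ l, p' l (ω l)) * F ω := by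
  induction J using Finset.induction_on generalizing p with
  | empty =>
    have : p = p' := funext fun l => hpp l (by simp)
    rw [this]
  | insert l₀ J _ ih =>
    -- The factor `l₀` is exchanged here; the induction hypothesis exchanges the others.
    rw [← ih (Function.update p l₀ (p' l₀))]
    · have key : ∀ r : ι → Bool → ℝ, r l₀ true + r l₀ false = 1 →
          ∑ ω, (∏ l, r l (ω l)) * F ω =
            (∑ ω, (∏ l ∈ Finset.univ.erase l₀, r l (ω l)) * F ω) / 2 := by
        intro r hr
        have hinv : Function.Involutive
            (fun ω : ι → Bool => Function.update ω l₀ (!ω l₀)) := by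
          intro ω
          simp
        have h1 : ∑ ω, (∏ l, r l (ω l)) * F ω =
            ∑ ω : ι → Bool, (r l₀ (!ω l₀) * ∏ l ∈ Finset.univ.erase l₀, r l (ω l)) * F ω := by
          rw [← Equiv.sum_comp hinv.toPerm]
          refine Finset.sum_congr rfl fun ω _ => ?_
          simp only [Function.Involutive.coe_toPerm]
          rw [hF l₀ (by simp), ← Finset.mul_prod_erase _ _ (Finset.mem_univ l₀)]
          congr 2
          · simp
          · refine Finset.prod_congr rfl fun l hl => ?_
            rw [Function.update_of_ne (Finset.ne_of_mem_erase hl)]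
        have h2 : ∑ ω, (∏ l, r l (ω l)) * F ω =
            ∑ ω : ι → Bool, (r l₀ (ω l₀) * ∏ l ∈ Finset.univ.erase l₀, r l (ω l)) * F ω := by
          refine Finset.sum_congr rfl fun ω _ => ?_
          rw [← Finset.mul_prod_erase _ _ (Finset.mem_univ l₀)]
        have h3 : ∑ ω : ι → Bool, (∏ l ∈ Finset.univ.erase l₀, r l (ω l)) * F ω =
            ∑ ω, (∏ l, r l (ω l)) * F ω + ∑ ω, (∏ l, r l (ω l)) * F ω := by
          nth_rewrite 1 [h1]
          rw [h2, ← Finset.sum_add_distrib]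
          refine Finset.sum_congr rfl fun ω _ => ?_
          have : r l₀ (!ω l₀) + r l₀ (ω l₀) = 1 := by
            cases ω l₀ <;> simp <;> linarith
          rw [← add_mul, ← add_mul, this, one_mul]
        linarith
      rw [key p (hp _), key _ (by simpa using hp' l₀)]
      congr 1
      refine Finset.sum_congr rfl fun ω _ => ?_
      congr 1
      refine Finset.prod_congr rfl fun l hl => ?_
      rw [Function.update_of_ne (Finset.ne_of_mem_erase hl)]
    · intro l
      by_cases h : l = l₀
      · subst h; simpa using hp' l
      · simpa [Function.update_of_ne h] using hp l
    · exact fun l hl => hF l (Finset.mem_insert_of_mem hl)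
    · intro l hl
      by_cases h : l = l₀
      · subst h; simp
      · rw [Function.update_of_ne h]
        exact hpp l (by simp [h, hl])

/-- Lower bound of the sum of the quadratic risks in a two-point testing problem through the
Hellinger affinity. -/
theorem two_mul_sq_mul_affinity_sq_le {Ω : Type*} [Fintype Ω] (P Q e : Ω → ℝ)
    (hP : ∀ ω, 0 ≤ P ω) (hQ : ∀ ω, 0 ≤ Q ω) (hP1 : ∑ ω, P ω = 1) (hQ1 : ∑ ω, Q ω = 1) (a : ℝ) :
    2 * a ^ 2 * (∑ ω, √(P ω) * √(Q ω)) ^ 2 ≤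
      ∑ ω, P ω * (e ω - a) ^ 2 + ∑ ω, Q ω * (e ω + a) ^ 2 := by
  have h1 := Finset.sum_mul_sq_le_sq_mul_sq Finset.univ (fun ω => √(P ω) * (e ω - a))
    (fun ω => √(Q ω))
  have h2 := Finset.sum_mul_sq_le_sq_mul_sq Finset.univ (fun ω => √(Q ω) * (e ω + a))
    (fun ω => √(P ω))
  simp only [mul_pow, Real.sq_sqrt (hP _), Real.sq_sqrt (hQ _), hP1, hQ1, mul_one] at h1 h2
  -- Since `2a = (e + a) - (e - a)`, the affinity is split into the two terms bounded by
  -- Cauchy–Schwarz.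
  have h3 : 2 * a * ∑ ω, √(P ω) * √(Q ω) =
      ∑ ω, √(Q ω) * (e ω + a) * √(P ω) - ∑ ω, √(P ω) * (e ω - a) * √(Q ω) := by
    rw [Finset.mul_sum, ← Finset.sum_sub_distrib]
    refine Finset.sum_congr rfl fun ω _ => ?_
    ring
  generalize ∑ ω, √(P ω) * √(Q ω) = ρ at *
  generalize ∑ ω, √(Q ω) * (e ω + a) * √(P ω) = x at *
  generalize ∑ ω, √(P ω) * (e ω - a) * √(Q ω) = y at *
  have h4 : 2 * a ^ 2 * ρ ^ 2 = (x - y) ^ 2 / 2 := by rw [← h3]; ring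
  nlinarith [sq_nonneg (x + y)]

theorem sum_prod_bool_eq_one {ι : Type*} [Fintype ι] [DecidableEq ι] (p : ι → Bool → ℝ)
    (hp : ∀ l, p l true + p l false = 1) : ∑ ω : ι → Bool, ∏ l, p l (ω l) = 1 := by
  rw [← Fintype.piFinset_univ, ← Finset.prod_univ_sum]
  simp [hp]

/-- Two-point bound for product measures on `{true, false}^ι`, for estimators which do not depend
on the coordinates in `J`. -/
theorem two_point_prod_bool {ι : Type*} [Fintype ι] [DecidableEq ι]
    (p q : ι → Bool → ℝ) (hp0 : ∀ l b, 0 ≤ p l b) (hq0 : ∀ l b, 0 ≤ q l b)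
    (hp : ∀ l, p l true + p l false = 1) (hq : ∀ l, q l true + q l false = 1)
    (J : Finset ι) (e : (ι → Bool) → ℝ)
    (he : ∀ l ∈ J, ∀ ω b, e (Function.update ω l b) = e ω) (a : ℝ) :
    2 * a ^ 2 * (∏ l ∈ Jᶜ, (√(p l true) * √(q l true) + √(p l false) * √(q l false))) ^ 2 ≤
      ∑ ω, (∏ l, p l (ω l)) * (e ω - a) ^ 2 + ∑ ω, (∏ l, q l (ω l)) * (e ω + a) ^ 2 := by
  -- The unread coins get the same law under both hypotheses, so they contribute affinity one.
  set q' : ι → Bool → ℝ := fun l => if l ∈ J then p l else q l with hq'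
  have hq'0 : ∀ l b, 0 ≤ q' l b := by
    intro l b
    by_cases h : l ∈ J <;> simp [hq', h, hp0, hq0]
  have hq'1 : ∀ l, q' l true + q' l false = 1 := by
    intro l
    by_cases h : l ∈ J <;> simp [hq', h, hp, hq]
  rw [sum_prod_mul_congr_of_invariant q q' hq hq'1 J (fun ω => (e ω + a) ^ 2)
    (fun l hl ω b => by rw [he l hl]) (fun l hl => by simp [hq', hl])]
  refine le_trans (le_of_eq ?_) (two_mul_sq_mul_affinity_sq_le _ _ e
    (fun ω => Finset.prod_nonneg fun l _ => hp0 l _)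
    (fun ω => Finset.prod_nonneg fun l _ => hq'0 l _)
    (sum_prod_bool_eq_one p hp) (sum_prod_bool_eq_one q' hq'1) a)
  congr 2
  have h1 : ∀ ω : ι → Bool, √(∏ l, p l (ω l)) * √(∏ l, q' l (ω l)) =
      ∏ l, √(p l (ω l)) * √(q' l (ω l)) := by
    intro ω
    rw [Real.sqrt_eq_rpow, Real.sqrt_eq_rpow,
      ← Real.finsetProd_rpow _ _ (fun l _ => hp0 l _),
      ← Real.finsetProd_rpow _ _ (fun l _ => hq'0 l _), ← Finset.prod_mul_distrib]
    simp [Real.sqrt_eq_rpow]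
  simp only [h1]
  rw [← Fintype.piFinset_univ, ← Finset.prod_univ_sum (fun _ => Finset.univ)
    (fun l b => √(p l b) * √(q' l b)), ← Finset.prod_mul_prod_compl J]
  have hJ : ∏ l ∈ J, ∑ b, √(p l b) * √(q' l b) = 1 :=
    Finset.prod_eq_one fun l hl => by simp [hq', hl, Real.mul_self_sqrt (hp0 _ _), hp]
  rw [hJ, one_mul]
  refine Finset.prod_congr rfl fun l hl => ?_
  have : l ∉ J := by simpa using hl
  simp [hq', this]

/-! ### The random sign model and its risk. -/

/-- The sign `±1` encoded by a Boolean. -/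
def boolSign (b : Bool) : ℝ := if b then 1 else -1

/-- The law of a random sign with mean `θ`. -/
noncomputable def signLaw (θ : ℝ) : Measure Bool :=
  ENNReal.ofReal ((1 + θ) / 2) • Measure.dirac true +
    ENNReal.ofReal ((1 - θ) / 2) • Measure.dirac false

theorem signLaw_singleton (θ : ℝ) (b : Bool) :
    signLaw θ {b} = ENNReal.ofReal ((1 + θ * boolSign b) / 2) := by
  cases b <;> simp [signLaw, boolSign, sub_eq_add_neg]

theorem isProbabilityMeasure_signLaw {θ : ℝ} (h : |θ| ≤ 1) :
    IsProbabilityMeasure (signLaw θ) := by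
  rw [abs_le] at h
  constructor
  simp only [signLaw, Measure.coe_add, Measure.coe_smul, Pi.add_apply, Pi.smul_apply, measure_univ,
    smul_eq_mul, mul_one]
  rw [← ENNReal.ofReal_add (by linarith) (by linarith)]
  ring_nf
  simp

theorem integral_boolSign {θ : ℝ} (h : |θ| ≤ 1) : ∫ b, boolSign b ∂(signLaw θ) = θ := by
  have := isProbabilityMeasure_signLaw h
  rw [abs_le] at h
  rw [integral_fintype .of_finite]
  simp only [Measure.real, signLaw_singleton, Fintype.sum_bool, boolSign]
  rw [ENNReal.toReal_ofReal (by simp; linarith), ENNReal.toReal_ofReal (by simp; linarith)]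
  simp only [if_true, smul_eq_mul]
  simp
  ring

theorem abs_boolSign (b : Bool) : |boolSign b| = 1 := by
  cases b <;> simp [boolSign]

theorem boolSign_not (b : Bool) : boolSign (!b) = -boolSign b := by
  cases b <;> simp [boolSign]

theorem abs_mul_boolSign_le {ε : ℝ} (hε0 : 0 ≤ ε) (hε1 : ε ≤ 1) (b : Bool) :
    |ε * boolSign b| ≤ 1 := by
  rw [abs_mul, abs_boolSign, mul_one, abs_of_nonneg hε0]
  exact hε1

/-- At each point at most one of the functions `φ k` does not vanish. -/
def PairwiseDisjointSupport {κ X : Type*} (φ : κ → X → ℝ) : Prop :=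
  ∀ x k l, φ k x ≠ 0 → φ l x ≠ 0 → k = l

theorem PairwiseDisjointSupport.sum_mul_eq {κ X : Type*} [Fintype κ] {φ : κ → X → ℝ}
    (h : PairwiseDisjointSupport φ) (c : κ → ℝ) {x : X} {k : κ} (hk : φ k x ≠ 0) :
    ∑ l, c l * φ l x = c k * φ k x := by
  refine Finset.sum_eq_single_of_mem k (Finset.mem_univ k) fun l _ hl => ?_
  have : φ l x = 0 := by
    by_contra h'
    exact hl (h x l k h' hk)
  simp [this]

theorem PairwiseDisjointSupport.abs_sum_mul_le {κ X : Type*} [Fintype κ] {φ : κ → X → ℝ}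
    (h : PairwiseDisjointSupport φ) {c : κ → ℝ} {C : ℝ} {x : X} (hφ : ∀ k, |φ k x| ≤ C)
    (hC : 0 ≤ C) (hc : ∀ k, |c k| ≤ 1) : |∑ l, c l * φ l x| ≤ C := by
  by_cases hx : ∃ k, φ k x ≠ 0
  · obtain ⟨k, hk⟩ := hx
    rw [h.sum_mul_eq c hk, abs_mul]
    calc |c k| * |φ k x| ≤ 1 * C := mul_le_mul (hc k) (hφ k) (abs_nonneg _) zero_le_one
      _ = C := one_mul C
  · push Not at hx
    simpa [hx] using hC

section SignModel

variable {d n m : ℕ} {D : Set (Fin d → ℝ)} {κ : Type} [Fintype κ]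

/-- The function `A ∑ k, ± φ k` with signs encoded by `ω`. -/
noncomputable def signedSum {X : Type*} (A : ℝ) (φ : κ → X → ℝ) (ω : κ → Bool) (x : X) : ℝ :=
  ∑ k, A * boolSign (ω k) * φ k x

theorem measurable_signedSum {X : Type*} [MeasurableSpace X] (A : ℝ) {φ : κ → X → ℝ}
    (hφ : ∀ k, Measurable (φ k)) :
    Measurable fun p : (κ → Bool) × X => signedSum A φ p.1 p.2 := by
  unfold signedSum
  refine Finset.measurable_sum _ fun k _ => ?_
  refine Measurable.mul (measurable_const.mul ?_) ((hφ k).comp measurable_snd)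
  exact (measurable_of_finite boolSign).comp ((measurable_pi_apply k).comp measurable_fst)

/-- The noiseless model in which `Z = A ∑ k, ξ k φ k`, with independent random signs `ξ k` of mean
`ε v k`, `v k ∈ {-1, 1}`. -/
noncomputable def signModel (d n m : ℕ) (D : Set (Fin d → ℝ)) (A : ℝ) {ε : ℝ} (hε0 : 0 ≤ ε)
    (hε1 : ε ≤ 1) {φ : κ → (Fin d → ℝ) → ℝ} (hφ : ∀ k, Measurable (φ k)) (v : κ → Bool) :
    RandomFunctionAndNoise d n m D where
  S := κ → Bool
  P := Measure.pi fun k => signLaw (ε * boolSign (v k))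
  isProbability_P := by
    have := fun k => isProbabilityMeasure_signLaw (abs_mul_boolSign_le hε0 hε1 (v k))
    infer_instance
  Z := signedSum A φ
  measurable_Z := (measurable_signedSum A hφ).comp
    (measurable_fst.prodMk (measurable_subtype_coe.comp measurable_snd))
  integrable_Z x _ := by
    have := fun k => isProbabilityMeasure_signLaw (abs_mul_boolSign_le hε0 hε1 (v k))
    exact .of_finite
  noise _ _ := Measure.dirac 0
  isProbability_noise _ _ := inferInstance
  integrable_noise _ _ := by simp [integrable_dirac]
  mean_noise _ _ := by simp

variable {A ε : ℝ} (hε0 : 0 ≤ ε) (hε1 : ε ≤ 1) {φ : κ → (Fin d → ℝ) → ℝ}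
  (hφ : ∀ k, Measurable (φ k)) (v : κ → Bool)

theorem regressionFunction_signModel :
    (signModel d n m D A hε0 hε1 hφ v).regressionFunction = signedSum (A * ε) φ v := by
  have hP := fun k => isProbabilityMeasure_signLaw (abs_mul_boolSign_le hε0 hε1 (v k))
  funext x
  change ∫ ω, signedSum A φ ω x ∂(Measure.pi fun k => signLaw (ε * boolSign (v k))) = _
  unfold signedSum
  rw [integral_finsetSum _ fun k _ => .of_finite]
  refine Finset.sum_congr rfl fun k _ => ?_
  rw [integral_mul_const, integral_const_mul]
  have := integral_comp_eval (μ := fun k => signLaw (ε * boolSign (v k))) (i := k)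
    (f := boolSign) (measurable_of_finite boolSign).aestronglyMeasurable
  rw [this, integral_boolSign (abs_mul_boolSign_le hε0 hε1 (v k))]
  ring

theorem abs_signedSum_le {X : Type*} {A : ℝ} {φ : κ → X → ℝ} {x : X} {C : ℝ} (hA : 0 ≤ A)
    (h : PairwiseDisjointSupport φ) (hφ : ∀ k, |φ k x| ≤ C) (hC : 0 ≤ C) (v : κ → Bool) :
    |signedSum A φ v x| ≤ A * C := by
  have : signedSum A φ v x = A * ∑ k, boolSign (v k) * φ k x := by
    simp only [signedSum, Finset.mul_sum, mul_assoc]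
  rw [this, abs_mul, abs_of_nonneg hA]
  exact mul_le_mul_of_nonneg_left
    (h.abs_sum_mul_le hφ hC fun k => (abs_boolSign _).le) hA

theorem isSubExponential_of_abs_le {S : Type*} [MeasurableSpace S] {μ : Measure S}
    [IsProbabilityMeasure μ] {Y : S → ℝ} {b : ℝ} (hb : 0 < b) (h : ∀ ω, |Y ω| ≤ b / 2) :
    IsSubExponential μ Y b := by
  refine ⟨fun h0 => absurd h0 hb.ne', fun _ => ?_⟩
  have h2 : ∀ ω, ENNReal.ofReal (Real.exp (|Y ω| / b)) ≤ 2 := by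
    intro ω
    have h1 : |Y ω| / b ≤ 1 / 2 := by
      rw [div_le_iff₀ hb]
      linarith [h ω]
    have h3 : Real.exp (1 / 2) ≤ 2 := by
      have := Real.exp_one_lt_d9
      have h4 : Real.exp (1 / 2) * Real.exp (1 / 2) = Real.exp 1 := by
        rw [← Real.exp_add]; norm_num
      nlinarith [Real.exp_pos (1 / 2)]
    rw [show (2 : ℝ≥0∞) = ENNReal.ofReal 2 by simp]
    exact ENNReal.ofReal_le_ofReal ((Real.exp_le_exp.2 h1).trans h3)
  calc _ ≤ ∫⁻ _, 2 ∂μ := lintegral_mono h2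
    _ = 2 := by simp

/-- By disjointness of the supports both `Z` and `f°` are bounded by `A`, so `|U| ≤ 2 A ≤ b₂ / 2`;
this fixes the constant `b₂ / 4`. -/
theorem regularProcessAndNoise_signModel {PX : Measure (Fin d → ℝ)} [IsProbabilityMeasure PX]
    {b₂ b₃ : ℝ} (hA : 0 ≤ A) (hb₂ : 0 < b₂) (hAb : A ≤ b₂ / 4)
    (hc : ∀ k, Continuous (φ k)) (hd : PairwiseDisjointSupport φ)
    (h1 : ∀ k x, |φ k x| ≤ 1) :
    (signModel d n m D A hε0 hε1 hφ v).RegularProcessAndNoise PX b₂ b₃ where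
  continuous_U ω := by
    have hs : ∀ (a : ℝ) (w : κ → Bool), Continuous (signedSum a φ w) := fun a w => by
      unfold signedSum
      exact continuous_finsetSum _ fun k _ => continuous_const.mul (hc k)
    unfold RandomFunctionAndNoise.U
    rw [regressionFunction_signModel]
    exact ((hs A ω).sub (hs (A * ε) v)).continuousOn
  subexp_U := by
    have := (signModel d n m D A hε0 hε1 hφ v).isProbability_P
    refine isSubExponential_of_abs_le hb₂ fun p => ?_
    unfold RandomFunctionAndNoise.U
    rw [regressionFunction_signModel]
    have e1 : |signedSum A φ p.1 p.2| ≤ A * 1 :=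
      abs_signedSum_le hA hd (fun k => h1 k p.2) zero_le_one _
    have e2 : |signedSum (A * ε) φ v p.2| ≤ A * ε * 1 :=
      abs_signedSum_le (mul_nonneg hA hε0) hd (fun k => h1 k p.2) zero_le_one _
    have e3 : A * ε ≤ A := mul_le_of_le_one_right hA hε1
    refine (abs_sub _ _).trans ?_
    change |signedSum A φ p.1 p.2| + _ ≤ _
    linarith
  subexp_noise i j := by
    refine ⟨fun _ => ?_, fun _ => ?_⟩
    · change ∀ᵐ e ∂(Measure.dirac (0 : ℝ)), e = 0
      simp [ae_dirac_eq]
    · change ∫⁻ e, ENNReal.ofReal (Real.exp (|e| / b₃)) ∂(Measure.dirac (0 : ℝ)) ≤ 2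
      simp

theorem measure_pi_dirac {ι : Type*} [Fintype ι] {α : ι → Type*} [∀ i, MeasurableSpace (α i)]
    (a : ∀ i, α i) : Measure.pi (fun i => Measure.dirac (a i)) = Measure.dirac a := by
  refine Measure.pi_eq fun s hs => ?_
  rw [Measure.dirac_apply' _ (MeasurableSet.univ_pi hs)]
  simp only [Measure.dirac_apply' _ (hs _)]
  by_cases h : ∀ i, a i ∈ s i
  · simp [h]
  · have h' := h
    push Not at h'
    obtain ⟨i, hi⟩ := h'
    rw [Finset.prod_eq_zero (Finset.mem_univ i) (by simp [hi])]
    simpa using h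

/-- The likelihood of the signs `ω`. -/
noncomputable def signWeight (ε : ℝ) (v : κ → Bool) (ω : Fin n → κ → Bool) : ℝ :=
  ∏ i, ∏ k, (1 + ε * boolSign (v k) * boolSign (ω i k)) / 2

theorem one_add_mul_boolSign_nonneg {ε : ℝ} (hε0 : 0 ≤ ε) (hε1 : ε ≤ 1) (b c : Bool) :
    0 ≤ (1 + ε * boolSign b * boolSign c) / 2 := by
  cases b <;> cases c <;> simp [boolSign] <;> linarith

/-- The signs take finitely many values and the noise is a point mass, so both integrate out. The
design stays in an inner integral: the testing bound is applied with the design fixed. -/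
theorem predictionError_signModel [DecidableEq κ] {PX : Measure (Fin d → ℝ)} [IsProbabilityMeasure PX]
    {est : (Fin n → Fin m → (Fin d → ℝ) × ℝ) → (Fin d → ℝ) → ℝ}
    (hest : Measurable (Function.uncurry est)) :
    (signModel d n m D A hε0 hε1 hφ v).predictionError PX est =
      ∑ ω : Fin n → κ → Bool, ENNReal.ofReal (signWeight ε v ω) *
        ∫⁻ X : Fin n → Fin m → Fin d → ℝ, ∫⁻ x,
          ENNReal.ofReal ((est (fun i j => (X i j, signedSum A φ (ω i) (X i j))) x -
            signedSum (A * ε) φ v x) ^ 2) ∂PX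
        ∂(Measure.pi fun _ => Measure.pi fun _ => PX) := by
  have hP := fun k => isProbabilityMeasure_signLaw (abs_mul_boolSign_le hε0 hε1 (v k))
  unfold RandomFunctionAndNoise.predictionError
  rw [regressionFunction_signModel]
  have hnoise : (Measure.pi fun i => Measure.pi fun j =>
      (signModel d n m D A hε0 hε1 hφ v).noise i j) = Measure.dirac 0 := by
    change (Measure.pi fun i : Fin n => Measure.pi fun j : Fin m => Measure.dirac (0 : ℝ)) = _
    rw [measure_pi_dirac]
    exact measure_pi_dirac _
  unfold RandomFunctionAndNoise.jointLaw
  rw [hnoise]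
  set F : ((Fin n → κ → Bool) × (Fin n → Fin m → Fin d → ℝ) × (Fin n → Fin m → ℝ)) → ℝ≥0∞ :=
    fun q => ∫⁻ x, ENNReal.ofReal
      ((est (fun i j => (q.2.1 i j, signedSum A φ (q.1 i) (q.2.1 i j) + q.2.2 i j)) x -
        signedSum (A * ε) φ v x) ^ 2) ∂PX with hF
  have hFm : Measurable F := by
    refine Measurable.lintegral_prod_right' (f := fun p : ((Fin n → κ → Bool) ×
      (Fin n → Fin m → Fin d → ℝ) × (Fin n → Fin m → ℝ)) × (Fin d → ℝ) => ENNReal.ofReal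
      ((est (fun i j => (p.1.2.1 i j, signedSum A φ (p.1.1 i) (p.1.2.1 i j) + p.1.2.2 i j)) p.2 -
        signedSum (A * ε) φ v p.2) ^ 2)) ?_
    refine ENNReal.measurable_ofReal.comp (Measurable.pow_const (Measurable.sub ?_ ?_) 2)
    · refine hest.comp (Measurable.prodMk ?_ measurable_snd)
      refine measurable_pi_lambda _ fun i => measurable_pi_lambda _ fun j => ?_
      have hX : Measurable fun p : ((Fin n → κ → Bool) ×
          (Fin n → Fin m → Fin d → ℝ) × (Fin n → Fin m → ℝ)) × (Fin d → ℝ) => p.1.2.1 i j := by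
        fun_prop
      refine hX.prodMk (Measurable.add ?_ (by fun_prop))
      refine (measurable_signedSum A hφ).comp (Measurable.prodMk ?_ hX)
      fun_prop
    · exact (measurable_signedSum (A * ε) hφ).comp (measurable_const.prodMk measurable_snd)
  change ∫⁻ q, F q ∂((Measure.pi fun _ : Fin n => Measure.pi fun k =>
    signLaw (ε * boolSign (v k))).prod _) = _
  rw [lintegral_prod _ hFm.aemeasurable, lintegral_fintype]
  refine Finset.sum_congr rfl fun ω _ => ?_
  rw [mul_comm]
  congr 1
  · rw [Measure.pi_singleton]
    simp only [Measure.pi_singleton, signLaw_singleton]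
    unfold signWeight
    rw [ENNReal.ofReal_prod_of_nonneg fun i _ =>
      Finset.prod_nonneg fun k _ => one_add_mul_boolSign_nonneg hε0 hε1 _ _]
    refine Finset.prod_congr rfl fun i _ => ?_
    rw [ENNReal.ofReal_prod_of_nonneg fun k _ => one_add_mul_boolSign_nonneg hε0 hε1 _ _]
  · have hFω : Measurable fun y => F (ω, y) := hFm.comp measurable_prodMk_left
    rw [lintegral_prod _ hFω.aemeasurable]
    refine lintegral_congr fun X => ?_
    have hFX : Measurable fun y => F (ω, X, y) := hFω.comp measurable_prodMk_left
    rw [lintegral_dirac' _ hFX]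
    simp [hF]

end SignModel

/-! ### Assouad's argument, conditionally on the design. -/

section Assouad

variable {d n m : ℕ} {D : Set (Fin d → ℝ)} {κ : Type} [Fintype κ] [DecidableEq κ]

/-- Flattens curve and bump indices into the single index type of `two_point_prod_bool`. -/
theorem sum_signWeight_mul_eq {ε : ℝ} (v : κ → Bool) (F : (Fin n → κ → Bool) → ℝ) :
    ∑ ω, signWeight ε v ω * F ω =
      ∑ ω : Fin n × κ → Bool, (∏ l, (1 + ε * boolSign (v l.2) * boolSign (ω l)) / 2) *
        F (Function.curry ω) := by
  rw [← Equiv.sum_comp (Equiv.curry (Fin n) κ Bool)]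
  refine Finset.sum_congr rfl fun ω _ => ?_
  rw [Fintype.prod_prod_type]
  rfl

/-- Flipping `v k` changes only the coins of bump `k`, and `e` reads those of the curves in `I`
only. Each of these has affinity `√(1 - ε²)`, all other read coins have affinity one, and
Bernoulli's inequality linearizes the power. -/
theorem signWeight_two_point {ε : ℝ} (hε0 : 0 ≤ ε) (hε1 : ε ≤ 1) (v : κ → Bool) (k : κ)
    (I : Finset (Fin n)) (e : (Fin n → κ → Bool) → ℝ)
    (he : ∀ i ∉ I, ∀ ω b, e (Function.update ω i (Function.update (ω i) k b)) = e ω) (a : ℝ) :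
    2 * a ^ 2 * (1 - I.card * ε ^ 2) ≤
      ∑ ω, signWeight ε v ω * (e ω - a) ^ 2 +
        ∑ ω, signWeight ε (Function.update v k (!v k)) ω * (e ω + a) ^ 2 := by
  rw [sum_signWeight_mul_eq, sum_signWeight_mul_eq]
  have hsum : ∀ b : Bool, (1 + ε * boolSign b * boolSign true) / 2 +
      (1 + ε * boolSign b * boolSign false) / 2 = 1 := by
    intro b
    simp only [boolSign]
    cases b <;> simp <;> ring
  have hinv : ∀ l ∈ (Iᶜ ×ˢ {k} : Finset (Fin n × κ)), ∀ (ω : Fin n × κ → Bool) b,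
      e (Function.curry (Function.update ω l b)) = e (Function.curry ω) := by
    rintro ⟨i, k'⟩ hl ω b
    simp only [Finset.mem_product, Finset.mem_singleton, Finset.mem_compl] at hl
    obtain ⟨hi, rfl⟩ := hl
    rw [← he i hi (Function.curry ω) b]
    congr 1
    funext i' k
    by_cases hi' : i' = i
    · subst hi'
      by_cases hk : k = k'
      · subst hk; simp [Function.curry]
      · simp [Function.curry, hk]
    · simp [Function.curry, hi']
  have key := two_point_prod_bool
    (fun (l : Fin n × κ) b => (1 + ε * boolSign (v l.2) * boolSign b) / 2)
    (fun l b => (1 + ε * boolSign (Function.update v k (!v k) l.2) * boolSign b) / 2)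
    (fun l b => one_add_mul_boolSign_nonneg hε0 hε1 _ _)
    (fun l b => one_add_mul_boolSign_nonneg hε0 hε1 _ _)
    (fun l => hsum _) (fun l => hsum _) (Iᶜ ×ˢ {k}) (fun ω => e (Function.curry ω)) hinv a
  refine le_trans ?_ key
  · refine mul_le_mul_of_nonneg_left ?_ (by positivity)
    have hsub : I ×ˢ {k} ⊆ ((Iᶜ ×ˢ {k})ᶜ : Finset (Fin n × κ)) := by
      intro l
      simp only [Finset.mem_product, Finset.mem_singleton, Finset.mem_compl]
      tauto
    have hε2 : ε ^ 2 ≤ 1 := pow_le_one₀ hε0 hε1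
    rw [← Finset.prod_subset hsub]
    · rw [Finset.prod_congr rfl (g := fun _ => √(1 - ε ^ 2))]
      · rw [Finset.prod_const, pow_right_comm, Real.sq_sqrt (by linarith)]
        simp only [Finset.card_product, Finset.card_singleton, mul_one]
        have := one_add_mul_le_pow (a := -ε ^ 2) (by linarith) I.card
        rw [show 1 - ε ^ 2 = 1 + -ε ^ 2 by ring]
        linarith
      · intro l hl
        have hlk : l.2 = k := by
          simp only [Finset.mem_product, Finset.mem_singleton] at hl
          exact hl.2
        rw [hlk, Function.update_self, ← Real.sqrt_mul (one_add_mul_boolSign_nonneg hε0 hε1 _ _),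
          ← Real.sqrt_mul (one_add_mul_boolSign_nonneg hε0 hε1 _ _), boolSign_not]
        have h1 : ∀ b c : Bool, (1 + ε * boolSign b * boolSign c) / 2 *
            ((1 + ε * -boolSign b * boolSign c) / 2) = (1 - ε ^ 2) * (1 / 2) ^ 2 := by
          intro b c
          simp only [boolSign]
          cases b <;> cases c <;> simp <;> ring
        rw [h1, h1, Real.sqrt_mul (by linarith), Real.sqrt_sq (by norm_num)]
        ring
    · intro l hl hl'
      have hlk : l.2 ≠ k := by
        intro h
        simp only [Finset.mem_product, Finset.mem_singleton, Finset.mem_compl, h] at hl hl'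
        tauto
      rw [Function.update_of_ne hlk,
        Real.mul_self_sqrt (one_add_mul_boolSign_nonneg hε0 hε1 _ _),
        Real.mul_self_sqrt (one_add_mul_boolSign_nonneg hε0 hε1 _ _), hsum]

/-- Each `v` is paired with its flip at `k`. Summed over `v`, the two risks of a pair agree, which
cancels the factor 2 of the two-point bound. -/
theorem sum_signWeight_risk {ε : ℝ} (hε0 : 0 ≤ ε) (hε1 : ε ≤ 1) (k : κ)
    (I : Finset (Fin n)) (e : (Fin n → κ → Bool) → ℝ)
    (he : ∀ i ∉ I, ∀ ω b, e (Function.update ω i (Function.update (ω i) k b)) = e ω) (a : ℝ) :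
    ∑ _v : κ → Bool, a ^ 2 * (1 - I.card * ε ^ 2) ≤
      ∑ v : κ → Bool, ∑ ω, signWeight ε v ω * (e ω - a * boolSign (v k)) ^ 2 := by
  have hinv : Function.Involutive (fun v : κ → Bool => Function.update v k (!v k)) := by
    intro v
    simp
  have h1 : ∑ v : κ → Bool, ∑ ω, signWeight ε v ω * (e ω - a * boolSign (v k)) ^ 2 =
      ∑ v : κ → Bool, ∑ ω, signWeight ε (Function.update v k (!v k)) ω *
        (e ω + a * boolSign (v k)) ^ 2 := by
    rw [← Equiv.sum_comp hinv.toPerm]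
    simp [boolSign_not]
  have h2 : ∑ v : κ → Bool, 2 * (a ^ 2 * (1 - I.card * ε ^ 2)) ≤
      ∑ v : κ → Bool, ∑ ω, signWeight ε v ω * (e ω - a * boolSign (v k)) ^ 2 +
      ∑ v : κ → Bool, ∑ ω, signWeight ε (Function.update v k (!v k)) ω *
        (e ω + a * boolSign (v k)) ^ 2 := by
    rw [← Finset.sum_add_distrib]
    refine Finset.sum_le_sum fun v _ => ?_
    refine le_trans (le_of_eq ?_)
      (signWeight_two_point hε0 hε1 v k I e he (a * boolSign (v k)))
    have : boolSign (v k) ^ 2 = 1 := by rw [← sq_abs, abs_boolSign, one_pow]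
    rw [mul_pow, this]
    ring
  rw [← h1, ← Finset.mul_sum] at h2
  linarith

/-- The curves which are observed at some point of the support of `ψ`. -/
noncomputable def observedCurves (ψ : (Fin d → ℝ) → ℝ) (X : Fin n → Fin m → Fin d → ℝ) :
    Finset (Fin n) :=
  open Classical in {i | ∃ j, ψ (X i j) ≠ 0}

/-- Where `φ k x ≠ 0`, the target depends on `v` through `v k` only, and a curve that misses the
support of `φ k` does not reveal its `k`-th sign. -/
theorem sum_signWeight_signedSum_risk {A ε : ℝ} (hε0 : 0 ≤ ε) (hε1 : ε ≤ 1)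
    {φ : κ → (Fin d → ℝ) → ℝ} (hd : PairwiseDisjointSupport φ)
    (est : (Fin n → Fin m → (Fin d → ℝ) × ℝ) → (Fin d → ℝ) → ℝ)
    (X : Fin n → Fin m → Fin d → ℝ) (x : Fin d → ℝ) (k : κ) (hk : φ k x ≠ 0) :
    ∑ _v : κ → Bool, (A * ε * φ k x) ^ 2 * (1 - (observedCurves (φ k) X).card * ε ^ 2) ≤
      ∑ v : κ → Bool, ∑ ω : Fin n → κ → Bool, signWeight ε v ω *
        (est (fun i j => (X i j, signedSum A φ (ω i) (X i j))) x -
            signedSum (A * ε) φ v x) ^ 2 := by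
  refine (sum_signWeight_risk hε0 hε1 k (observedCurves (φ k) X)
    (fun ω => est (fun i j => (X i j, signedSum A φ (ω i) (X i j))) x) ?_ _).trans
    (le_of_eq ?_)
  · intro i hi ω b
    have hi' : ∀ j, φ k (X i j) = 0 := by
      simpa [observedCurves] using hi
    congr 1
    funext i' j
    congr 1
    by_cases h : i' = i
    · subst h
      rw [Function.update_self]
      unfold signedSum
      refine Finset.sum_congr rfl fun l _ => ?_
      by_cases hl : l = k
      · subst hl; simp [hi']
      · simp [hl]
    · simp [h]
  · refine Finset.sum_congr rfl fun v _ => Finset.sum_congr rfl fun ω _ => ?_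
    congr 3
    unfold signedSum
    rw [hd.sum_mul_eq (fun l => A * ε * boolSign (v l)) hk]
    ring

/-- There are at most as many observed curves as design points in the support. -/
theorem lintegral_card_observedCurves_le {PX : Measure (Fin d → ℝ)} [IsProbabilityMeasure PX]
    {ψ : (Fin d → ℝ) → ℝ} (hψ : Measurable ψ) :
    ∫⁻ X : Fin n → Fin m → Fin d → ℝ, ((observedCurves ψ X).card : ℝ≥0∞)
      ∂(Measure.pi fun _ => Measure.pi fun _ => PX) ≤ n * m * PX {x | ψ x ≠ 0} := by
  classical
  have hms : MeasurableSet {x | ψ x ≠ 0} := (hψ (measurableSet_singleton 0)).compl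
  have h1 : ∀ X : Fin n → Fin m → Fin d → ℝ, ((observedCurves ψ X).card : ℝ≥0∞) ≤
      ∑ i, ∑ j, {x | ψ x ≠ 0}.indicator (fun _ => (1 : ℝ≥0∞)) (X i j) := by
    intro X
    unfold observedCurves
    rw [Finset.card_filter]
    push_cast
    refine Finset.sum_le_sum fun i _ => ?_
    by_cases h : ∃ j, ψ (X i j) ≠ 0
    · rw [if_pos h]
      obtain ⟨j, hj⟩ := h
      refine le_trans ?_ (Finset.single_le_sum (fun _ _ => zero_le) (Finset.mem_univ j))
      simp [hj]
    · rw [if_neg h]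
      exact zero_le
  refine (lintegral_mono h1).trans (le_of_eq ?_)
  have hm : ∀ (i : Fin n) (j : Fin m), Measurable fun X : Fin n → Fin m → Fin d → ℝ =>
      {x | ψ x ≠ 0}.indicator (fun _ => (1 : ℝ≥0∞)) (X i j) := fun i j =>
    (measurable_const.indicator hms).comp ((measurable_pi_apply j).comp (measurable_pi_apply i))
  rw [lintegral_finsetSum _ fun i _ => Finset.measurable_sum _ fun j _ => hm i j]
  have h2 : ∀ (i : Fin n) (j : Fin m), ∫⁻ X : Fin n → Fin m → Fin d → ℝ,
      {x | ψ x ≠ 0}.indicator (fun _ => (1 : ℝ≥0∞)) (X i j)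
      ∂(Measure.pi fun _ => Measure.pi fun _ => PX) = PX {x | ψ x ≠ 0} := by
    intro i j
    have hmp := (measurePreserving_eval (fun _ : Fin m => PX) j).comp
      (measurePreserving_eval (fun _ : Fin n => Measure.pi fun _ : Fin m => PX) i)
    have := hmp.lintegral_comp (f := {x | ψ x ≠ 0}.indicator (fun _ => (1 : ℝ≥0∞)))
      (measurable_const.indicator hms)
    simp only [Function.comp_apply, Function.eval] at this
    rw [this, lintegral_indicator_const hms, one_mul]
  simp_rw [lintegral_finsetSum _ fun j _ => hm _ j, h2]
  simp [mul_assoc]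

theorem measurable_card_observedCurves {ψ : (Fin d → ℝ) → ℝ} (hψ : Measurable ψ) :
    Measurable fun X : Fin n → Fin m → Fin d → ℝ => (observedCurves ψ X).card := by
  classical
  unfold observedCurves
  simp only [Finset.card_filter]
  refine Finset.measurable_sum _ fun i _ => Measurable.ite ?_ measurable_const measurable_const
  have : {X : Fin n → Fin m → Fin d → ℝ | ∃ j, ψ (X i j) ≠ 0} =
      ⋃ j, {X | ψ (X i j) = 0}ᶜ := by
    ext X
    simp
  rw [this]
  refine MeasurableSet.iUnion fun j => MeasurableSet.compl ?_
  exact (hψ.comp ((measurable_pi_apply j).comp (measurable_pi_apply i)))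
    (measurableSet_singleton 0)

/-- Integrate `1 ≤ (1 - r ε²)₊ + r ε²`; `ENNReal.ofReal` supplies the positive part. -/
theorem half_le_lintegral_ofReal_one_sub {S : Type*} [MeasurableSpace S] {μ : Measure S}
    [IsProbabilityMeasure μ] {r : S → ℕ} (hr : Measurable r) {ε : ℝ}
    (h : (∫⁻ X, (r X : ℝ≥0∞) ∂μ) * ENNReal.ofReal (ε ^ 2) ≤ 1 / 2) :
    1 / 2 ≤ ∫⁻ X, ENNReal.ofReal (1 - r X * ε ^ 2) ∂μ := by
  have hr' : Measurable fun X => (r X : ℝ≥0∞) := (measurable_of_countable _).comp hr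
  have h1 : (1 : ℝ≥0∞) ≤ ∫⁻ X, ENNReal.ofReal (1 - r X * ε ^ 2) ∂μ + 1 / 2 := by
    calc (1 : ℝ≥0∞) = ∫⁻ _, 1 ∂μ := by simp
      _ ≤ ∫⁻ X, (ENNReal.ofReal (1 - r X * ε ^ 2) +
          (r X : ℝ≥0∞) * ENNReal.ofReal (ε ^ 2)) ∂μ := by
        refine lintegral_mono fun X => ?_
        have : (r X : ℝ≥0∞) * ENNReal.ofReal (ε ^ 2) = ENNReal.ofReal (r X * ε ^ 2) := by
          rw [ENNReal.ofReal_mul (by positivity), ENNReal.ofReal_natCast]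
        rw [this, ← ENNReal.ofReal_one]
        refine le_trans (ENNReal.ofReal_le_ofReal (le_of_eq ?_)) ENNReal.ofReal_add_le
        ring
      _ ≤ _ := by
        rw [lintegral_add_right _ (hr'.mul_const _), lintegral_mul_const _ hr']
        gcongr
  have h2 : (1 / 2 : ℝ≥0∞) ≠ ∞ := by simp
  exact (ENNReal.add_le_add_iff_right h2).1 ((ENNReal.add_halves 1).trans_le h1)

theorem half_le_lintegral_observedCurves {PX : Measure (Fin d → ℝ)} [IsProbabilityMeasure PX]
    {ψ : (Fin d → ℝ) → ℝ} (hψ : Measurable ψ) {ε : ℝ}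
    (h : (n : ℝ≥0∞) * ENNReal.ofReal (ε ^ 2) ≤ 1 / 2 ∨
      n * m * PX {x | ψ x ≠ 0} * ENNReal.ofReal (ε ^ 2) ≤ 1 / 2) :
    1 / 2 ≤ ∫⁻ X : Fin n → Fin m → Fin d → ℝ,
      ENNReal.ofReal (1 - (observedCurves ψ X).card * ε ^ 2)
      ∂(Measure.pi fun _ => Measure.pi fun _ => PX) := by
  refine half_le_lintegral_ofReal_one_sub (measurable_card_observedCurves hψ) ?_
  rcases h with h | h
  · refine le_trans (mul_le_mul_left ?_ _) h
    calc _ ≤ ∫⁻ _ : Fin n → Fin m → Fin d → ℝ, (n : ℝ≥0∞)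
          ∂(Measure.pi fun _ => Measure.pi fun _ => PX) := by
          refine lintegral_mono fun X => ?_
          have := Finset.card_le_univ (observedCurves ψ X)
          rw [Fintype.card_fin] at this
          exact Nat.cast_le.2 this
      _ = n := by simp
  · exact le_trans (mul_le_mul_left (lintegral_card_observedCurves_le hψ) _) h

/-- Assouad's bound for the models `signModel`. -/
theorem exists_le_predictionError_signModel {PX : Measure (Fin d → ℝ)} [IsProbabilityMeasure PX]
    {A ε : ℝ} (hε0 : 0 ≤ ε) (hε1 : ε ≤ 1) {φ : κ → (Fin d → ℝ) → ℝ}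
    (hφ : ∀ k, Measurable (φ k)) (hd : PairwiseDisjointSupport φ)
    (hinfo : ∀ k, (n : ℝ≥0∞) * ENNReal.ofReal (ε ^ 2) ≤ 1 / 2 ∨
      n * m * PX {x | φ k x ≠ 0} * ENNReal.ofReal (ε ^ 2) ≤ 1 / 2)
    {est : (Fin n → Fin m → (Fin d → ℝ) × ℝ) → (Fin d → ℝ) → ℝ}
    (hest : Measurable (Function.uncurry est)) :
    ∃ v, ENNReal.ofReal ((A * ε) ^ 2) * (∑ k, ∫⁻ x, ENNReal.ofReal (φ k x ^ 2) ∂PX) * (1 / 2) ≤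
      (signModel d n m D A hε0 hε1 hφ v).predictionError PX est := by
  set μ : Measure (Fin n → Fin m → Fin d → ℝ) := Measure.pi fun _ => Measure.pi fun _ => PX
    with hμ
  set G : (κ → Bool) → (Fin n → κ → Bool) → (Fin n → Fin m → Fin d → ℝ) × (Fin d → ℝ) → ℝ≥0∞ :=
    fun v ω p => ENNReal.ofReal
      ((est (fun i j => (p.1 i j, signedSum A φ (ω i) (p.1 i j))) p.2 -
        signedSum (A * ε) φ v p.2) ^ 2) with hG
  have hGm : ∀ v ω, Measurable (G v ω) := by
    intro v ω
    refine ENNReal.measurable_ofReal.comp (Measurable.pow_const (Measurable.sub ?_ ?_) 2)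
    · refine hest.comp (Measurable.prodMk ?_ measurable_snd)
      refine measurable_pi_lambda _ fun i => measurable_pi_lambda _ fun j => ?_
      have hX : Measurable fun p : (Fin n → Fin m → Fin d → ℝ) × (Fin d → ℝ) => p.1 i j := by
        fun_prop
      exact hX.prodMk ((measurable_signedSum A hφ).comp (measurable_const.prodMk hX))
    · exact (measurable_signedSum (A * ε) hφ).comp (measurable_const.prodMk measurable_snd)
  have hR : ∀ v, (signModel d n m D A hε0 hε1 hφ v).predictionError PX est =
      ∫⁻ p, ∑ ω, ENNReal.ofReal (signWeight ε v ω) * G v ω p ∂(μ.prod PX) := by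
    intro v
    rw [predictionError_signModel hε0 hε1 hφ v hest,
      lintegral_finsetSum _ fun ω _ => (hGm v ω).const_mul _]
    refine Finset.sum_congr rfl fun ω _ => ?_
    rw [lintegral_const_mul _ (hGm v ω), lintegral_prod _ (hGm v ω).aemeasurable]
  -- The constant is kept as a sum over `v`, so that some `v` must satisfy the bound termwise.
  suffices h : ∑ _v : κ → Bool, ENNReal.ofReal ((A * ε) ^ 2) *
      (∑ k, ∫⁻ x, ENNReal.ofReal (φ k x ^ 2) ∂PX) * (1 / 2) ≤
      ∑ v, (signModel d n m D A hε0 hε1 hφ v).predictionError PX est by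
    obtain ⟨v, -, hv⟩ := ENNReal.exists_le_of_sum_le Finset.univ_nonempty h
    exact ⟨v, hv⟩
  have hw : ∀ v (ω : Fin n → κ → Bool), 0 ≤ signWeight ε v ω := fun v ω =>
    Finset.prod_nonneg fun i _ => Finset.prod_nonneg fun k _ =>
      one_add_mul_boolSign_nonneg hε0 hε1 _ _
  -- Pointwise in the design and in `x`, at most one bump is nonzero, so the one-coordinate bound
  -- suffices.
  have hpt : ∀ p : (Fin n → Fin m → Fin d → ℝ) × (Fin d → ℝ),
      ∑ _v : κ → Bool, ENNReal.ofReal ((A * ε) ^ 2) * ∑ k,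
        ENNReal.ofReal (1 - (observedCurves (φ k) p.1).card * ε ^ 2) *
          ENNReal.ofReal (φ k p.2 ^ 2) ≤
      ∑ v, ∑ ω, ENNReal.ofReal (signWeight ε v ω) * G v ω p := by
    rintro ⟨X, x⟩
    by_cases hx : ∃ k, φ k x ≠ 0
    · obtain ⟨k, hk⟩ := hx
      have hsum : ∑ l, ENNReal.ofReal (1 - (observedCurves (φ l) X).card * ε ^ 2) *
          ENNReal.ofReal (φ l x ^ 2) =
          ENNReal.ofReal (1 - (observedCurves (φ k) X).card * ε ^ 2) *
          ENNReal.ofReal (φ k x ^ 2) := by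
        refine Finset.sum_eq_single_of_mem k (Finset.mem_univ k) fun l _ hl => ?_
        have : φ l x = 0 := by
          by_contra h'
          exact hl (hd x l k h' hk)
        simp [this]
      have hreal := ENNReal.ofReal_le_ofReal
        (sum_signWeight_signedSum_risk (A := A) hε0 hε1 hd est X x k hk)
      rw [ENNReal.ofReal_sum_of_nonneg (fun v _ => Finset.sum_nonneg fun ω _ =>
        mul_nonneg (hw v ω) (sq_nonneg _))] at hreal
      simp_rw [ENNReal.ofReal_sum_of_nonneg (fun ω _ =>
        mul_nonneg (hw _ ω) (sq_nonneg _)), ENNReal.ofReal_mul (hw _ _)] at hreal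
      refine le_trans (le_of_eq ?_) hreal
      simp only [hsum]
      rw [Finset.sum_const, Finset.sum_const, ENNReal.ofReal_nsmul]
      congr 1
      rw [← ENNReal.ofReal_mul' (sq_nonneg _), ← ENNReal.ofReal_mul (sq_nonneg _)]
      congr 1
      ring
    · push Not at hx
      simp [hx]
  simp_rw [hR]
  rw [← lintegral_finsetSum _ fun v _ => Finset.measurable_sum _ fun ω _ =>
    (hGm v ω).const_mul _]
  refine le_trans ?_ (lintegral_mono hpt)
  have hm1 : ∀ k, Measurable fun X : Fin n → Fin m → Fin d → ℝ =>
      ENNReal.ofReal (1 - (observedCurves (φ k) X).card * ε ^ 2) := fun k =>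
    (measurable_of_countable fun r : ℕ => ENNReal.ofReal (1 - r * ε ^ 2)).comp
      (measurable_card_observedCurves (hφ k))
  have hm2 : ∀ k, Measurable fun x => ENNReal.ofReal (φ k x ^ 2) := fun k =>
    ENNReal.measurable_ofReal.comp ((hφ k).pow_const 2)
  have hm3 : ∀ k, Measurable fun p : (Fin n → Fin m → Fin d → ℝ) × (Fin d → ℝ) =>
      ENNReal.ofReal (1 - (observedCurves (φ k) p.1).card * ε ^ 2) *
          ENNReal.ofReal (φ k p.2 ^ 2) := fun k =>
    ((hm1 k).comp measurable_fst).mul ((hm2 k).comp measurable_snd)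
  have hm4 := Finset.measurable_sum Finset.univ fun k _ => hm3 k
  rw [lintegral_finsetSum _ fun v _ => hm4.const_mul _]
  refine Finset.sum_le_sum fun v _ => ?_
  rw [lintegral_const_mul _ hm4, mul_assoc, lintegral_finsetSum _ fun k _ => hm3 k,
    Finset.sum_mul]
  gcongr with k _
  rw [lintegral_prod_mul (hm1 k).aemeasurable (hm2 k).aemeasurable, mul_comm]
  gcongr
  exact half_le_lintegral_observedCurves (hφ k) (hinfo k)

end Assouad

/-! ### Grid bumps and their anisotropic Hölder norm. -/

/-- A smooth function supported in `(0, 1)` which equals `1` on `[δ, 1 - δ]`. -/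
theorem exists_smooth_plateau {δ : ℝ} (hδ0 : 0 < δ) (hδ1 : δ ≤ 1 / 4) :
    ∃ w : ℝ → ℝ, ContDiff ℝ (⊤ : ℕ∞) w ∧ (∀ t, |w t| ≤ 1) ∧ (∀ t ∈ Set.Icc δ (1 - δ), w t = 1) ∧
      (∀ r t, t ∉ Set.Ioo (0 : ℝ) 1 → iteratedDeriv r w t = 0) ∧
      ∀ r, ∃ C, ∀ t, |iteratedDeriv r w t| ≤ C := by
  -- The outer radius is below `1/2`, so `f` vanishes near every point outside `(0, 1)`, endpoints
  -- included, and so do all derivatives.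
  let f : ContDiffBump (1 / 2 : ℝ) := ⟨1 / 2 - δ, 1 / 2 - δ / 2, by linarith, by linarith⟩
  have hsm : ContDiff ℝ (⊤ : ℕ∞) f := f.contDiff
  have hzero : ∀ r t, t ∉ Set.Ioo (0 : ℝ) 1 → iteratedDeriv r f t = 0 := by
    intro r t ht
    have hev : (f : ℝ → ℝ) =ᶠ[nhds t] fun _ => 0 := by
      have hmem : (Set.Icc (δ / 2) (1 - δ / 2))ᶜ ∈ nhds t :=
        isClosed_Icc.isOpen_compl.mem_nhds fun h =>
          ht ⟨by linarith [h.1], by linarith [h.2]⟩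
      filter_upwards [hmem] with y hy
      refine f.zero_of_le_dist ?_
      by_contra! hlt
      rw [Real.dist_eq, abs_lt] at hlt
      change -(1 / 2 - δ / 2) < _ ∧ _ < 1 / 2 - δ / 2 at hlt
      exact hy ⟨by linarith [hlt.1], by linarith [hlt.2]⟩
    rw [hev.iteratedDeriv_eq]
    simp
  refine ⟨f, hsm, fun t => ?_, fun t ht => ?_, hzero, fun r => ?_⟩
  · rw [abs_of_nonneg f.nonneg]
    exact f.le_one
  · refine f.one_of_mem_closedBall ?_
    rw [Metric.mem_closedBall, Real.dist_eq, abs_le]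
    change -(1 / 2 - δ) ≤ _ ∧ _ ≤ 1 / 2 - δ
    constructor <;> linarith [ht.1, ht.2]
  · have hc : Continuous (iteratedDeriv r f) :=
      hsm.continuous_iteratedDeriv r (by exact_mod_cast le_top)
    obtain ⟨C, hC⟩ := isCompact_Icc.exists_bound_of_continuousOn
      (s := Set.Icc (0 : ℝ) 1) hc.continuousOn
    refine ⟨C, fun t => ?_⟩
    by_cases ht : t ∈ Set.Icc (0 : ℝ) 1
    · exact hC t ht
    · rw [hzero r t fun h => ht (Set.Ioo_subset_Icc_self h), abs_zero]
      exact (norm_nonneg _).trans (hC 0 (by simp))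

section BoxBump

variable {d : ℕ} (N : Fin d → ℕ) (w : ℝ → ℝ)

/-- The `r`-th derivative in the `i`-th coordinate of the product bump function
`∏ j, w (N j * x j - k j)`. -/
noncomputable def boxBumpDeriv (i : Fin d) (r : ℕ) (k : ∀ i, Fin (N i)) (x : Fin d → ℝ) : ℝ :=
  (N i : ℝ) ^ r * iteratedDeriv r w (N i * x i - (k i : ℕ)) *
    ∏ j ∈ Finset.univ.erase i, w (N j * x j - (k j : ℕ))

/-- The product bump function on the box with index `k` of the grid with `N i` cells in the
`i`-th coordinate. -/
noncomputable def boxBump (k : ∀ i, Fin (N i)) (x : Fin d → ℝ) : ℝ :=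
  ∏ j, w (N j * x j - (k j : ℕ))

variable {N w}

theorem boxBumpDeriv_zero (i : Fin d) (k : ∀ i, Fin (N i)) :
    boxBumpDeriv N w i 0 k = boxBump N w k := by
  funext x
  simp only [boxBumpDeriv, boxBump, pow_zero, one_mul, iteratedDeriv_zero]
  exact Finset.mul_prod_erase Finset.univ (fun j => w (N j * x j - (k j : ℕ))) (Finset.mem_univ i)

theorem continuous_boxBump (hw : Continuous w) (k : ∀ i, Fin (N i)) :
    Continuous (boxBump N w k) := by
  unfold boxBump
  fun_prop

theorem abs_boxBumpDeriv_le (hw1 : ∀ t, |w t| ≤ 1) {r : ℕ} {C : ℝ}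
    (hC : ∀ t, |iteratedDeriv r w t| ≤ C) (i : Fin d) (k : ∀ i, Fin (N i)) (x : Fin d → ℝ) :
    |boxBumpDeriv N w i r k x| ≤ (N i : ℝ) ^ r * C := by
  have hC0 : 0 ≤ C := (abs_nonneg _).trans (hC 0)
  unfold boxBumpDeriv
  rw [abs_mul, abs_mul, Finset.abs_prod, abs_of_nonneg (by positivity : (0 : ℝ) ≤ (N i : ℝ) ^ r)]
  refine (mul_le_of_le_one_right (by positivity)
    (Finset.prod_le_one (fun j _ => abs_nonneg _) fun j _ => hw1 _)).trans ?_
  exact mul_le_mul_of_nonneg_left (hC _) (by positivity)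

theorem mem_Ioo_of_boxBumpDeriv_ne_zero
    (hw0 : ∀ r t, t ∉ Set.Ioo (0 : ℝ) 1 → iteratedDeriv r w t = 0) {i : Fin d} {r : ℕ}
    {k : ∀ i, Fin (N i)} {x : Fin d → ℝ} (h : boxBumpDeriv N w i r k x ≠ 0) (j : Fin d) :
    (N j * x j - (k j : ℕ) : ℝ) ∈ Set.Ioo (0 : ℝ) 1 := by
  by_contra hj
  refine h ?_
  unfold boxBumpDeriv
  by_cases hji : j = i
  · subst hji
    rw [hw0 r _ hj, mul_zero, zero_mul]
  · have h0 := hw0 0 _ hj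
    rw [iteratedDeriv_zero] at h0
    rw [Finset.prod_eq_zero (Finset.mem_erase.2 ⟨hji, Finset.mem_univ j⟩) h0, mul_zero]

theorem pairwiseDisjointSupport_boxBumpDeriv
    (hw0 : ∀ r t, t ∉ Set.Ioo (0 : ℝ) 1 → iteratedDeriv r w t = 0) (i : Fin d) (r : ℕ) :
    PairwiseDisjointSupport (boxBumpDeriv N w i r) := by
  intro x k l hk hl
  funext j
  obtain ⟨h1, h2⟩ := mem_Ioo_of_boxBumpDeriv_ne_zero hw0 hk j
  obtain ⟨h3, h4⟩ := mem_Ioo_of_boxBumpDeriv_ne_zero hw0 hl j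
  have h5 : ((k j : ℕ) : ℝ) < (l j : ℕ) + 1 := by linarith
  have h6 : ((l j : ℕ) : ℝ) < (k j : ℕ) + 1 := by linarith
  norm_cast at h5 h6
  exact Fin.ext (by omega)

theorem hasDerivAt_boxBumpDeriv (hw : ContDiff ℝ (⊤ : ℕ∞) w) (i : Fin d) (r : ℕ)
    (k : ∀ i, Fin (N i)) (x : Fin d → ℝ) :
    HasDerivAt (fun t : ℝ => boxBumpDeriv N w i r k (x + Pi.single i t))
      (boxBumpDeriv N w i (r + 1) k x) 0 := by
  have h1 : (fun t : ℝ => boxBumpDeriv N w i r k (x + Pi.single i t)) = fun t =>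
      (N i : ℝ) ^ r * iteratedDeriv r w (N i * (x i + t) - (k i : ℕ)) *
        ∏ j ∈ Finset.univ.erase i, w (N j * x j - (k j : ℕ)) := by
    funext t
    unfold boxBumpDeriv
    congr 1
    · simp
    · refine Finset.prod_congr rfl fun j hj => ?_
      simp [Finset.ne_of_mem_erase hj]
  have h2 : HasDerivAt (fun t : ℝ => (N i * (x i + t) - (k i : ℕ) : ℝ)) (N i) 0 := by
    have := (((hasDerivAt_id (0 : ℝ)).const_add (x i)).const_mul (N i : ℝ)).sub_const
      ((k i : ℕ) : ℝ)
    simpa using this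
  have h3 : HasDerivAt (iteratedDeriv r w) (iteratedDeriv (r + 1) w (N i * x i - (k i : ℕ)))
      (N i * (x i + 0) - (k i : ℕ)) := by
    rw [add_zero, iteratedDeriv_succ]
    exact (hw.differentiable_iteratedDeriv r (by exact_mod_cast WithTop.coe_lt_top r) _).hasDerivAt
  rw [h1]
  have h4 := ((h3.comp (0 : ℝ) h2).const_mul ((N i : ℝ) ^ r)).mul_const
    (∏ j ∈ Finset.univ.erase i, w (N j * x j - (k j : ℕ)))
  refine h4.congr_deriv ?_
  unfold boxBumpDeriv
  ring

theorem hasDerivAt_signedSum_boxBumpDeriv (hw : ContDiff ℝ (⊤ : ℕ∞) w) (a : ℝ)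
    (v : (∀ i, Fin (N i)) → Bool) (i : Fin d) (r : ℕ) (x : Fin d → ℝ) (t : ℝ) :
    HasDerivAt (fun t : ℝ => signedSum a (boxBumpDeriv N w i r) v (x + Pi.single i t))
      (signedSum a (boxBumpDeriv N w i (r + 1)) v (x + Pi.single i t)) t := by
  have h0 : ∀ y : Fin d → ℝ,
      HasDerivAt (fun t : ℝ => signedSum a (boxBumpDeriv N w i r) v (y + Pi.single i t))
        (signedSum a (boxBumpDeriv N w i (r + 1)) v y) 0 := fun y =>
    HasDerivAt.fun_sum fun k _ => (hasDerivAt_boxBumpDeriv hw i r k y).const_mul _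
  have h1 := h0 (x + Pi.single i t)
  rw [← sub_self t] at h1
  have h2 := HasDerivAt.comp_sub_const t t h1
  refine h2.congr_of_eventuallyEq (Filter.Eventually.of_forall fun u => ?_)
  simp only [add_assoc, ← Pi.single_add, add_sub_cancel]

/-- Mean value inequality along a full coordinate line; the domain `D`, which may have gaps, plays
no role. -/
theorem abs_sub_add_single_le {f f' : (Fin d → ℝ) → ℝ} {M : ℝ} (i : Fin d) (x : Fin d → ℝ)
    (t : ℝ) (hf : ∀ u : ℝ, HasDerivAt (fun u : ℝ => f (x + Pi.single i u))
      (f' (x + Pi.single i u)) u) (hM : ∀ y, |f' y| ≤ M) :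
    |f x - f (x + Pi.single i t)| ≤ M * |t| := by
  have h1 := convex_univ.norm_image_sub_le_of_norm_hasDerivWithin_le
    (fun u _ => (hf u).hasDerivWithinAt) (fun u _ => hM (x + Pi.single i u))
    (Set.mem_univ t) (Set.mem_univ 0)
  simpa using h1

theorem abs_signedSum_boxBumpDeriv_sub_le (hw : ContDiff ℝ (⊤ : ℕ∞) w) {a M : ℝ}
    (v : (∀ i, Fin (N i)) → Bool) (i : Fin d) (r : ℕ) (x : Fin d → ℝ) (t : ℝ)
    (hM : ∀ y, |signedSum a (boxBumpDeriv N w i (r + 1)) v y| ≤ M) :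
    |signedSum a (boxBumpDeriv N w i r) v x -
      signedSum a (boxBumpDeriv N w i r) v (x + Pi.single i t)| ≤ M * |t| :=
  abs_sub_add_single_le (f' := signedSum a (boxBumpDeriv N w i (r + 1)) v) i x t
    (fun u => hasDerivAt_signedSum_boxBumpDeriv hw a v i r x u) hM

/-- Interpolates between the sup bound and the Lipschitz bound to get a Hölder bound. -/
theorem le_two_mul_rpow_of_le {y X u γ : ℝ} (hX : 0 ≤ X) (hu : 0 < u) (hγ0 : 0 ≤ γ)
    (hγ1 : γ ≤ 1) (h1 : y ≤ 2 * X) (h2 : y ≤ X * u) : y ≤ 2 * X * u ^ γ := by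
  rcases le_total u 1 with h | h
  · have h3 : u ≤ u ^ γ := by
      conv_lhs => rw [← Real.rpow_one u]
      exact Real.rpow_le_rpow_of_exponent_ge hu h hγ1
    have h4 := mul_le_mul_of_nonneg_left h3 hX
    have h5 := mul_nonneg hX (Real.rpow_nonneg hu.le γ)
    linarith
  · exact h1.trans (le_mul_of_one_le_right (by linarith) (Real.one_le_rpow h hγ0))

/-- Disjoint supports make the sup bounds those of a single bump, whatever the number of cells. An
`r`-th derivative in direction `i` costs `N i ^ r`, so `a * N i ^ s i ≤ b` controls all terms; the
factor 2 is needed for the Hölder quotient only. -/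
theorem anisoHolderNorm_signedSum_boxBump_le (D : Set (Fin d → ℝ)) {s : Fin d → ℝ}
    (hs : ∀ i, 0 < s i) (hN : ∀ i, 1 ≤ N i) (hw : ContDiff ℝ (⊤ : ℕ∞) w) (hw1 : ∀ t, |w t| ≤ 1)
    (hw0 : ∀ r t, t ∉ Set.Ioo (0 : ℝ) 1 → iteratedDeriv r w t = 0) {C : ℝ}
    (hC : ∀ i, ∀ r ≤ ⌈s i⌉₊, ∀ t, |iteratedDeriv r w t| ≤ C) {a b : ℝ} (hC0 : 0 ≤ C) (ha : 0 ≤ a)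
    (hab : ∀ i, a * (N i : ℝ) ^ s i ≤ b) (v : (∀ i, Fin (N i)) → Bool) :
    anisoHolderNorm D s (signedSum a (boxBump N w) v) ≤
      (∑ i, (⌈s i⌉₊ + 1 : ℕ)) * ENNReal.ofReal (2 * (b * C)) := by
  have hceil : ∀ i, 1 ≤ ⌈s i⌉₊ := fun i => Nat.one_le_ceil_iff.2 (hs i)
  have hN' : ∀ i, (1 : ℝ) ≤ N i := fun i => by exact_mod_cast hN i
  have hbound : ∀ i, ∀ r ≤ ⌈s i⌉₊, ∀ x, |signedSum a (boxBumpDeriv N w i r) v x| ≤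
      a * ((N i : ℝ) ^ r * C) := fun i r hr x =>
    abs_signedSum_le ha (pairwiseDisjointSupport_boxBumpDeriv hw0 i r)
      (fun k => abs_boxBumpDeriv_le hw1 (hC i r hr) i k x) (by positivity) v
  have hfam : IsPartialDerivFamily D s (signedSum a (boxBump N w) v)
      (fun i r => signedSum a (boxBumpDeriv N w i r) v) := by
    refine ⟨fun i x _ => ?_, fun i k _ x _ => ?_⟩
    · simp only [signedSum, boxBumpDeriv_zero]
    · have := hasDerivAt_signedSum_boxBumpDeriv hw a v i k x 0
      simp only [Pi.single_zero, add_zero] at this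
      exact this.hasDerivWithinAt
  refine (iInf₂_le _ hfam).trans ?_
  push_cast
  rw [Finset.sum_mul, ← Finset.sum_add_distrib]
  refine Finset.sum_le_sum fun i _ => ?_
  rw [add_mul, one_mul]
  refine add_le_add ?_ ?_
  · refine (Finset.sum_le_card_nsmul _ _ (ENNReal.ofReal (2 * (b * C))) fun r hr => ?_).trans
      (le_of_eq (by simp))
    refine iSup₂_le fun x _ => ENNReal.ofReal_le_ofReal ?_
    have hr' := Finset.mem_range.1 hr
    have hrs : (r : ℝ) ≤ s i := (Nat.lt_ceil.1 hr').le
    have h1 : (N i : ℝ) ^ r ≤ (N i : ℝ) ^ s i := by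
      rw [← Real.rpow_natCast]
      exact Real.rpow_le_rpow_of_exponent_le (hN' i) hrs
    have h2 : a * ((N i : ℝ) ^ r * C) ≤ b * C := by
      rw [← mul_assoc]
      exact mul_le_mul_of_nonneg_right
        ((mul_le_mul_of_nonneg_left h1 ha).trans (hab i)) hC0
    have h3 := hbound i r hr'.le x
    have h4 : 0 ≤ b * C := ((abs_nonneg _).trans h3).trans h2
    linarith
  · refine iSup₂_le fun x _ => iSup₂_le fun t ht => iSup_le fun _ =>
      ENNReal.ofReal_le_ofReal ?_
    obtain ⟨L, hL, hL1⟩ : ∃ L, ⌈s i⌉₊ - 1 = L ∧ L + 1 = ⌈s i⌉₊ :=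
      ⟨_, rfl, Nat.sub_add_cancel (hceil i)⟩
    rw [hL]
    have hLs : (L : ℝ) < s i := Nat.lt_ceil.1 (by omega)
    have hγ1 : s i - L ≤ 1 := by
      have h1 := Nat.le_ceil (s i)
      rw [← hL1] at h1
      push_cast at h1
      linarith
    have ht' : 0 < |t| := abs_pos.2 ht
    rw [div_le_iff₀ (Real.rpow_pos_of_pos ht' _)]
    have hNi : (0 : ℝ) < N i := by linarith [hN' i]
    have hL' : L ≤ ⌈s i⌉₊ := by omega
    have hx := hbound i L hL' x
    have hxt := hbound i L hL' (x + Pi.single i t)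
    have hA := (abs_sub _ _).trans (add_le_add hx hxt)
    have hM : ∀ y, |signedSum a (boxBumpDeriv N w i (L + 1)) v y| ≤
        a * ((N i : ℝ) ^ (L + 1) * C) := hbound i (L + 1) hL1.le
    have hB := abs_signedSum_boxBumpDeriv_sub_le hw v i L x t hM
    -- One more derivative costs a factor `N i`, hence the natural length scale `1 / N i` in `u`.
    have hC' := le_two_mul_rpow_of_le (X := a * ((N i : ℝ) ^ L * C)) (u := N i * |t|)
      (γ := s i - L) (by positivity) (mul_pos hNi ht') (by linarith) hγ1
      (hA.trans (le_of_eq (two_mul _).symm)) (hB.trans (le_of_eq (by rw [pow_succ]; ring)))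
    refine hC'.trans ?_
    rw [Real.mul_rpow hNi.le ht'.le, ← mul_assoc]
    refine mul_le_mul_of_nonneg_right ?_ (Real.rpow_nonneg ht'.le _)
    have h5 : (N i : ℝ) ^ L * (N i : ℝ) ^ (s i - L) = (N i : ℝ) ^ s i := by
      rw [← Real.rpow_natCast, ← Real.rpow_add hNi]
      congr 1
      ring
    calc 2 * (a * ((N i : ℝ) ^ L * C)) * (N i : ℝ) ^ (s i - L)
        = 2 * (a * ((N i : ℝ) ^ L * (N i : ℝ) ^ (s i - L)) * C) := by ring
      _ = 2 * (a * (N i : ℝ) ^ s i * C) := by rw [h5]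
      _ ≤ 2 * (b * C) := by
        have := mul_le_mul_of_nonneg_right (hab i) hC0
        linarith

end BoxBump

/-! ### Mass of grid cells and plateaus under the uniform law. -/

section UniformLaw

variable {d : ℕ} {D : Set (Fin d → ℝ)}

theorem volume_le_one_of_subset_Icc (hD : D ⊆ Set.Icc 0 1) : volume D ≤ 1 := by
  refine (measure_mono hD).trans ?_
  rw [Real.volume_Icc_pi]
  simp

theorem isProbabilityMeasure_uniformLaw (hD : D ⊆ Set.Icc 0 1) (hD_pos : volume D ≠ 0) :
    IsProbabilityMeasure (uniformLaw D) := by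
  constructor
  have h1 : volume D ≠ ∞ := ((volume_le_one_of_subset_Icc hD).trans_lt ENNReal.one_lt_top).ne
  simp [uniformLaw, ENNReal.inv_mul_cancel hD_pos h1]

theorem uniformLaw_le (E : Set (Fin d → ℝ)) : uniformLaw D E ≤ (volume D)⁻¹ * volume E := by
  simp only [uniformLaw, Measure.coe_smul, Pi.smul_apply, smul_eq_mul]
  gcongr
  exact Measure.restrict_le_self

theorem volume_slab_le (i : Fin d) (a b : ℝ) :
    volume {x : Fin d → ℝ | x ∈ Set.Icc 0 1 ∧ x i ∈ Set.Icc a b} ≤ ENNReal.ofReal (b - a) := by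
  have hsub : {x : Fin d → ℝ | x ∈ Set.Icc 0 1 ∧ x i ∈ Set.Icc a b} ⊆
      Set.pi Set.univ fun j => if j = i then Set.Icc a b else Set.Icc (0 : ℝ) 1 := by
    rintro x ⟨hx, hxi⟩ j -
    by_cases h : j = i
    · subst h; simpa using hxi
    · simpa [h] using ⟨hx.1 j, hx.2 j⟩
  refine (measure_mono hsub).trans (le_of_eq ?_)
  rw [volume_pi_pi, Finset.prod_eq_single i]
  · simp
  · intro j _ h
    simp [h]
  · simp

/-- The points of the unit cube which are close to the boundary of the cells of a grid. -/
def gridMargin (N : Fin d → ℕ) (δ : ℝ) : Set (Fin d → ℝ) :=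
  {x | x ∈ Set.Icc 0 1 ∧
    ¬ ∃ k : ∀ i, Fin (N i), ∀ j, (N j * x j - (k j : ℕ) : ℝ) ∈ Set.Icc δ (1 - δ)}

/-- Direction `i` contributes `N i` pairs of slabs of width `δ / N i`, so the bound does not depend
on the grid. -/
theorem volume_gridMargin_le {N : Fin d → ℕ} (hN : ∀ i, 1 ≤ N i) {δ : ℝ} (hδ : 0 ≤ δ) :
    volume (gridMargin N δ) ≤ ENNReal.ofReal (2 * d * δ) := by
  set E : Fin d → ℕ → Set (Fin d → ℝ) := fun i q =>
    {x | x ∈ Set.Icc 0 1 ∧ x i ∈ Set.Icc ((q : ℝ) / N i) ((q + δ) / N i)} ∪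
    {x | x ∈ Set.Icc 0 1 ∧ x i ∈ Set.Icc ((q + 1 - δ : ℝ) / N i) ((q + 1) / N i)} with hE
  have hNpos : ∀ i, (0 : ℝ) < N i := fun i => by exact_mod_cast hN i
  have hsub : gridMargin N δ ⊆ ⋃ i, ⋃ q ∈ Finset.range (N i), E i q := by
    rintro x ⟨hx, hxk⟩
    by_contra hcon
    simp only [Set.mem_iUnion, Finset.mem_range, not_exists] at hcon
    -- The minimum puts the face `x i = 1` into the last cell.
    refine hxk ⟨fun i => ⟨min ⌊(N i : ℝ) * x i⌋₊ (N i - 1), ?_⟩, fun i => ?_⟩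
    · have := hN i
      omega
    · set q := min ⌊(N i : ℝ) * x i⌋₊ (N i - 1) with hq
      have hqN : q < N i := by
        have := hN i
        omega
      have hx0 : 0 ≤ (N i : ℝ) * x i := mul_nonneg (hNpos i).le (hx.1 i)
      have hx1 : (N i : ℝ) * x i ≤ N i := mul_le_of_le_one_right (hNpos i).le (hx.2 i)
      have h1 : (q : ℝ) ≤ N i * x i :=
        (Nat.cast_le.2 (min_le_left _ _)).trans (Nat.floor_le hx0)
      have h2 : (N i : ℝ) * x i ≤ q + 1 := by
        rcases le_total ⌊(N i : ℝ) * x i⌋₊ (N i - 1) with h | h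
        · rw [hq, min_eq_left h]
          exact (Nat.lt_floor_add_one _).le
        · rw [hq, min_eq_right h]
          have h3 : ((N i - 1 : ℕ) : ℝ) + 1 = N i := by
            exact_mod_cast Nat.sub_add_cancel (hN i)
          rw [h3]
          exact hx1
      have h4 := hcon i q hqN
      simp only [hE, Set.mem_union, Set.mem_ofPred_eq, not_or, not_and, Set.mem_Icc] at h4
      constructor
      · by_contra! hlt
        refine h4.1 hx ((div_le_iff₀ (hNpos i)).2 (by linarith))
          ((le_div_iff₀ (hNpos i)).2 (by simp only at hlt; linarith))
      · by_contra! hlt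
        refine h4.2 hx ((div_le_iff₀ (hNpos i)).2 (by simp only at hlt; linarith))
          ((le_div_iff₀ (hNpos i)).2 (by linarith))
  have hEv : ∀ i q, volume (E i q) ≤ ENNReal.ofReal (2 * δ / N i) := by
    intro i q
    refine (measure_union_le _ _).trans ((add_le_add (volume_slab_le i _ _)
      (volume_slab_le i _ _)).trans (le_of_eq ?_))
    have h1 : (q + δ) / N i - q / N i = δ / N i := by ring
    have h2 : ((q : ℝ) + 1) / N i - (q + 1 - δ) / N i = δ / N i := by ring
    have h3 : 0 ≤ δ / N i := div_nonneg hδ (hNpos i).le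
    rw [h1, h2, ← ENNReal.ofReal_add h3 h3]
    congr 1
    ring
  calc volume (gridMargin N δ) ≤ volume (⋃ i, ⋃ q ∈ Finset.range (N i), E i q) := measure_mono hsub
    _ ≤ ∑ i, volume (⋃ q ∈ Finset.range (N i), E i q) := measure_iUnion_fintype_le _ _
    _ ≤ ∑ i, ∑ q ∈ Finset.range (N i), volume (E i q) :=
      Finset.sum_le_sum fun i _ => measure_biUnion_finset_le _ _
    _ ≤ ∑ i : Fin d, ∑ q ∈ Finset.range (N i), ENNReal.ofReal (2 * δ / N i) :=
      Finset.sum_le_sum fun i _ => Finset.sum_le_sum fun q _ => hEv i q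
    _ = ∑ i : Fin d, ENNReal.ofReal (2 * δ) := by
      refine Finset.sum_congr rfl fun i _ => ?_
      rw [Finset.sum_const, Finset.card_range, ← ENNReal.ofReal_nsmul]
      congr 1
      have := (hNpos i).ne'
      rw [nsmul_eq_mul]
      field_simp
    _ = ENNReal.ofReal (2 * d * δ) := by
      rw [Finset.sum_const, Finset.card_univ, Fintype.card_fin, ← ENNReal.ofReal_nsmul]
      congr 1
      rw [nsmul_eq_mul]
      ring

/-- With this `δ` the margin has at most half the volume of `D`, so the plateaus keep half the mass
however irregular `D` is. -/
theorem half_le_uniformLaw_diff_gridMargin (hD : D ⊆ Set.Icc 0 1) (hD_pos : volume D ≠ 0)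
    (hd : 0 < d) {N : Fin d → ℕ} (hN : ∀ i, 1 ≤ N i) :
    1 / 2 ≤ uniformLaw D (D \ gridMargin N ((volume D).toReal / (4 * d))) := by
  have hp := isProbabilityMeasure_uniformLaw hD hD_pos
  have hfin : volume D ≠ ∞ := ((volume_le_one_of_subset_Icc hD).trans_lt ENNReal.one_lt_top).ne
  set M := gridMargin N ((volume D).toReal / (4 * d)) with hM
  have hd' : (0 : ℝ) < d := by exact_mod_cast hd
  have h1 : uniformLaw D M ≤ 1 / 2 := by
    refine (uniformLaw_le M).trans ?_
    have h2 := volume_gridMargin_le hN (δ := (volume D).toReal / (4 * d)) (by positivity)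
    have h3 : 2 * d * ((volume D).toReal / (4 * d)) = (volume D).toReal * (1 / 2) := by
      field_simp
      ring
    rw [h3, ENNReal.ofReal_mul (by positivity), ENNReal.ofReal_toReal hfin] at h2
    calc (volume D)⁻¹ * volume M ≤ (volume D)⁻¹ * (volume D * ENNReal.ofReal (1 / 2)) := by
          gcongr
      _ = 1 / 2 := by
        rw [← mul_assoc, ENNReal.inv_mul_cancel hD_pos hfin, one_mul,
          ENNReal.ofReal_div_of_pos (by norm_num)]
        simp
  have h4 : uniformLaw D D = 1 := by
    simp [uniformLaw, ENNReal.inv_mul_cancel hD_pos hfin]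
  have h5 : (1 : ℝ≥0∞) ≤ uniformLaw D (D \ M) + 1 / 2 := by
    calc (1 : ℝ≥0∞) = uniformLaw D D := h4.symm
      _ ≤ uniformLaw D ((D \ M) ∪ M) := measure_mono (by simp)
      _ ≤ uniformLaw D (D \ M) + uniformLaw D M := measure_union_le _ _
      _ ≤ _ := by gcongr
  have h2 : (1 / 2 : ℝ≥0∞) ≠ ∞ := by simp
  exact (ENNReal.add_le_add_iff_right h2).1 ((ENNReal.add_halves 1).trans_le h5)

theorem half_le_sum_lintegral_boxBump_sq (hD : D ⊆ Set.Icc 0 1) (hD_pos : volume D ≠ 0)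
    (hd : 0 < d) {N : Fin d → ℕ} (hN : ∀ i, 1 ≤ N i) {w : ℝ → ℝ}
    (hw : Continuous w) (hw1 : ∀ t ∈ Set.Icc ((volume D).toReal / (4 * d))
      (1 - (volume D).toReal / (4 * d)), w t = 1) :
    1 / 2 ≤ ∑ k, ∫⁻ x, ENNReal.ofReal (boxBump N w k x ^ 2) ∂(uniformLaw D) := by
  have hm : ∀ k, Measurable fun x => ENNReal.ofReal (boxBump N w k x ^ 2) := fun k =>
    ENNReal.measurable_ofReal.comp ((continuous_boxBump hw k).measurable.pow_const 2)
  rw [← lintegral_finsetSum _ fun k _ => hm k]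
  refine (half_le_uniformLaw_diff_gridMargin hD hD_pos hd hN).trans ?_
  refine le_trans (measure_mono ?_) ((one_mul _).symm.le.trans
    (mul_meas_ge_le_lintegral (Finset.measurable_sum _ fun k _ => hm k) 1))
  rintro x ⟨hxD, hx⟩
  obtain ⟨k, hk⟩ : ∃ k : ∀ i, Fin (N i), ∀ j, (N j * x j - (k j : ℕ) : ℝ) ∈
      Set.Icc ((volume D).toReal / (4 * d)) (1 - (volume D).toReal / (4 * d)) := by
    by_contra h
    exact hx ⟨hD hxD, h⟩
  have hone : boxBump N w k x = 1 := Finset.prod_eq_one fun j _ => hw1 _ (hk j)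
  refine le_trans ?_ (Finset.single_le_sum
    (f := fun k => ENNReal.ofReal (boxBump N w k x ^ 2)) (fun _ _ => zero_le) (Finset.mem_univ k))
  simp [hone]

theorem uniformLaw_boxBump_ne_zero_le {N : Fin d → ℕ} (hN : ∀ i, 1 ≤ N i) {w : ℝ → ℝ}
    (hw0 : ∀ t, t ∉ Set.Ioo (0 : ℝ) 1 → w t = 0) (k : ∀ i, Fin (N i)) :
    uniformLaw D {x | boxBump N w k x ≠ 0} ≤
      (volume D)⁻¹ * ENNReal.ofReal (∏ i, (N i : ℝ)⁻¹) := by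
  refine (uniformLaw_le _).trans ?_
  gcongr
  have hNpos : ∀ i, (0 : ℝ) < N i := fun i => by exact_mod_cast hN i
  have hsub : {x | boxBump N w k x ≠ 0} ⊆
      Set.Icc (fun i => ((k i : ℕ) : ℝ) / N i) (fun i => (((k i : ℕ) : ℝ) + 1) / N i) := by
    intro x hx
    have h : ∀ i, (N i * x i - (k i : ℕ) : ℝ) ∈ Set.Ioo (0 : ℝ) 1 := by
      intro i
      by_contra hi
      exact hx (Finset.prod_eq_zero (Finset.mem_univ i) (hw0 _ hi))
    refine ⟨fun i => ?_, fun i => ?_⟩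
    · exact (div_le_iff₀ (hNpos i)).2 (by linarith [(h i).1])
    · exact (le_div_iff₀ (hNpos i)).2 (by linarith [(h i).2])
  refine (measure_mono hsub).trans (le_of_eq ?_)
  rw [Real.volume_Icc_pi, ENNReal.ofReal_prod_of_nonneg fun i _ => (inv_pos.2 (hNpos i)).le]
  refine Finset.prod_congr rfl fun i _ => ?_
  congr 1
  ring

end UniformLaw

/-! ### From the sign model to the minimax risk. -/

theorem anisoHolderNorm_const_le {d : ℕ} (D : Set (Fin d → ℝ)) (s : Fin d → ℝ) {a b : ℝ} (hab : |a| ≤ b) :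
    anisoHolderNorm D s (fun _ => a) ≤ (∑ i, (⌈s i⌉₊ + 1 : ℕ)) * ENNReal.ofReal b := by
  have hb : 0 ≤ b := (abs_nonneg a).trans hab
  have hfam : IsPartialDerivFamily D s (fun _ => a) (fun _ r _ => if r = 0 then a else 0) := by
    refine ⟨fun _ _ _ => by simp, fun i k _ x _ => ?_⟩
    simpa using hasDerivWithinAt_const (0 : ℝ) _ (if k = 0 then a else 0)
  refine (iInf₂_le _ hfam).trans ?_
  push_cast
  rw [Finset.sum_mul, ← Finset.sum_add_distrib]
  refine Finset.sum_le_sum fun i _ => ?_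
  rw [add_mul, one_mul]
  refine add_le_add ?_ ?_
  · refine (Finset.sum_le_card_nsmul _ _ (ENNReal.ofReal b) fun r _ => ?_).trans
      (le_of_eq (by simp))
    refine iSup₂_le fun x _ => ENNReal.ofReal_le_ofReal ?_
    split_ifs
    · exact hab
    · simpa using hb
  · refine iSup₂_le fun x _ => iSup₂_le fun t ht => iSup_le fun _ => ?_
    simp

theorem le_minimaxPredictionError_of_signModel {d n m : ℕ} {D : Set (Fin d → ℝ)} {κ : Type}
    [Fintype κ] [DecidableEq κ] {PX : Measure (Fin d → ℝ)} [IsProbabilityMeasure PX]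
    {s : Fin d → ℝ} {B b₂ b₃ ε : ℝ} (hb₂ : 0 < b₂) (hε0 : 0 ≤ ε) (hε1 : ε ≤ 1)
    {φ : κ → (Fin d → ℝ) → ℝ} (hφ : ∀ k, Continuous (φ k)) (hd : PairwiseDisjointSupport φ)
    (h1 : ∀ k x, |φ k x| ≤ 1)
    (hinfo : ∀ k, (n : ℝ≥0∞) * ENNReal.ofReal (ε ^ 2) ≤ 1 / 2 ∨
      n * m * PX {x | φ k x ≠ 0} * ENNReal.ofReal (ε ^ 2) ≤ 1 / 2)
    (hnorm : ∀ v, anisoHolderNorm D s (signedSum (b₂ / 4 * ε) φ v) ≤ ENNReal.ofReal B) :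
    ENNReal.ofReal ((b₂ / 4 * ε) ^ 2) * (∑ k, ∫⁻ x, ENNReal.ofReal (φ k x ^ 2) ∂PX) * (1 / 2) ≤
      minimaxPredictionError n m D PX s B b₂ b₃ := by
  refine le_iInf₂ fun est hest => ?_
  obtain ⟨v, hv⟩ := exists_le_predictionError_signModel (D := D) (A := b₂ / 4) hε0 hε1
    (fun k => (hφ k).measurable) hd hinfo hest
  refine hv.trans ?_
  refine le_iSup_of_le (signModel d n m D (b₂ / 4) hε0 hε1 (fun k => (hφ k).measurable) v) ?_
  refine le_iSup₂_of_le (regularProcessAndNoise_signModel hε0 hε1 _ v (by positivity) hb₂ le_rfl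
    hφ hd h1) ?_ le_rfl
  rw [regressionFunction_signModel]
  exact hnorm v

/-- Gives a factor `q`, free of `n` and `m`, that enforces both the Hölder and the information
constraint. -/
theorem exists_pos_scale {x y B : ℝ} (hx : 0 < x) (hy : 0 < y) (hB : 0 < B) :
    ∃ q : ℝ, 0 < q ∧ q ≤ 1 ∧ q * x ≤ B ∧ q * y ≤ 1 / 2 := by
  refine ⟨min 1 (min (B / x) (1 / 2 / y)), by positivity, min_le_left _ _, ?_, ?_⟩
  · rw [← le_div_iff₀ hx]
    exact (min_le_right _ _).trans (min_le_left _ _)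
  · rw [← le_div_iff₀ hy]
    exact (min_le_right _ _).trans (min_le_right _ _)

/-! ### The two rates and their combination. -/

section Rates

variable {d : ℕ} {D : Set (Fin d → ℝ)} {s : Fin d → ℝ} {B b₂ b₃ : ℝ}

/-- With constant curves the data amount to at most `n` coins of bias `±q / √n`, whatever `m` is. -/
theorem exists_parametric_lower_bound {PX : Measure (Fin d → ℝ)} [IsProbabilityMeasure PX]
    (hB : 0 < B) (hb₂ : 0 < b₂) :
    ∃ c : ℝ, 0 < c ∧ ∀ n m : ℕ, 1 ≤ n →
      ENNReal.ofReal (c * (n : ℝ)⁻¹) ≤ minimaxPredictionError n m D PX s B b₂ b₃ := by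
  set Q : ℕ := ∑ i, (⌈s i⌉₊ + 1) with hQ
  -- `Q + 1` in place of `Q` keeps the argument positive for `d = 0`.
  obtain ⟨q, hq0, hq1, hqx, hqy⟩ := exists_pos_scale (x := (Q + 1) * (b₂ / 4)) (y := 1)
    (by positivity) one_pos hB
  refine ⟨(b₂ / 4 * q) ^ 2 / 2, by positivity, fun n m hn => ?_⟩
  have hn' : (1 : ℝ) ≤ n := by exact_mod_cast hn
  have hsq : (√(n : ℝ))⁻¹ ^ 2 = (n : ℝ)⁻¹ := by rw [inv_pow, Real.sq_sqrt (by linarith)]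
  have hs1 : (√(n : ℝ))⁻¹ ≤ 1 := inv_le_one_of_one_le₀ (Real.one_le_sqrt.2 hn')
  have hs0 : 0 ≤ (√(n : ℝ))⁻¹ := by positivity
  have hmain := le_minimaxPredictionError_of_signModel (n := n) (m := m) (D := D) (PX := PX)
    (κ := Unit) (s := s) (B := B) (b₂ := b₂) (b₃ := b₃) (ε := q * (√(n : ℝ))⁻¹)
    (φ := fun _ _ => 1) hb₂ (by positivity) (mul_le_one₀ hq1 hs0 hs1)
    (fun _ => continuous_const) (fun _ _ _ _ _ => rfl) (by simp) ?_ ?_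
  · refine le_trans (le_of_eq ?_) hmain
    have hhalf : (1 / 2 : ℝ≥0∞) = ENNReal.ofReal (1 / 2) := by
      rw [ENNReal.ofReal_div_of_pos (by norm_num)]
      simp
    simp only [one_pow, ENNReal.ofReal_one, lintegral_one, measure_univ, Finset.univ_unique,
      Finset.sum_singleton, mul_one]
    rw [hhalf, ← ENNReal.ofReal_mul (by positivity), ← hsq]
    congr 1
    ring
  · intro _
    left
    rw [← ENNReal.ofReal_natCast, ← ENNReal.ofReal_mul (by positivity), mul_pow, hsq]
    have h1 : (n : ℝ) * (q ^ 2 * (n : ℝ)⁻¹) ≤ 1 / 2 := by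
      have : (n : ℝ) * (q ^ 2 * (n : ℝ)⁻¹) = q ^ 2 := by
        field_simp
      rw [this]
      nlinarith
    refine (ENNReal.ofReal_le_ofReal h1).trans (le_of_eq ?_)
    rw [ENNReal.ofReal_div_of_pos (by norm_num)]
    simp
  · intro v
    have hfun : signedSum (b₂ / 4 * (q * (√(n : ℝ))⁻¹))
        (fun (_ : Unit) (_ : Fin d → ℝ) => (1 : ℝ)) v =
        fun _ => b₂ / 4 * (q * (√(n : ℝ))⁻¹) * boolSign (v ()) := by
      funext x
      simp [signedSum]
    rw [hfun]
    refine (anisoHolderNorm_const_le D s (b := b₂ / 4 * q) ?_).trans ?_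
    · rw [abs_mul, abs_boolSign, mul_one, abs_of_nonneg (by positivity)]
      exact mul_le_mul_of_nonneg_left (mul_le_of_le_one_right hq0.le hs1) (by positivity)
    · rw [← hQ, ← ENNReal.ofReal_natCast, ← ENNReal.ofReal_mul (by positivity)]
      refine ENNReal.ofReal_le_ofReal (le_trans ?_ hqx)
      nlinarith [mul_pos hb₂ hq0]

theorem exists_nonparametric_lower_bound (hd : 0 < d)
    (hD : D ⊆ Set.Icc 0 1) (hD_pos : volume D ≠ 0) (hs : ∀ i, 0 < s i) (hB : 0 < B)
    (hb₂ : 0 < b₂) :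
    ∃ c : ℝ, 0 < c ∧ ∀ n m : ℕ, 1 ≤ n → 1 ≤ m →
      ENNReal.ofReal (c * ((n : ℝ) * m) ^ (-(2 / (2 + ∑ i, (s i)⁻¹)))) ≤
        minimaxPredictionError n m D (uniformLaw D) s B b₂ b₃ := by
  have hprob := isProbabilityMeasure_uniformLaw hD hD_pos
  have hfin : volume D ≠ ∞ := ((volume_le_one_of_subset_Icc hD).trans_lt ENNReal.one_lt_top).ne
  set V := (volume D).toReal with hV
  have hV0 : 0 < V := ENNReal.toReal_pos hD_pos hfin
  have hV1 : V ≤ 1 := ENNReal.toReal_le_of_le_ofReal zero_le_one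
    (by simpa using volume_le_one_of_subset_Icc hD)
  have hd1 : (1 : ℝ) ≤ d := by exact_mod_cast hd
  obtain ⟨w, hw, hw1, hwp, hw0, hwC⟩ := exists_smooth_plateau (δ := V / (4 * d)) (by positivity)
    (by rw [div_le_iff₀ (by positivity)]; linarith)
  choose K hK using hwC
  -- The range contains all orders `r ≤ ⌈s i⌉₊` for every `i` at once.
  set C : ℝ := ∑ r ∈ Finset.range (∑ i, ⌈s i⌉₊ + 1), |K r| + 1 with hC
  have hC0 : 0 < C := by positivity
  have hKC : ∀ i, ∀ r ≤ ⌈s i⌉₊, ∀ t, |iteratedDeriv r w t| ≤ C := by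
    intro i r hr t
    have h1 : ⌈s i⌉₊ ≤ ∑ i, ⌈s i⌉₊ :=
      Finset.single_le_sum (f := fun i => ⌈s i⌉₊) (fun _ _ => Nat.zero_le _) (Finset.mem_univ i)
    have h2 : |K r| ≤ ∑ r ∈ Finset.range (∑ i, ⌈s i⌉₊ + 1), |K r| :=
      Finset.single_le_sum (f := fun r => |K r|) (fun _ _ => abs_nonneg _)
        (Finset.mem_range.2 (by omega))
    linarith [hK r t, le_abs_self (K r)]
  set Q : ℕ := ∑ i, (⌈s i⌉₊ + 1) with hQ
  obtain ⟨q, hq0, hq1, hqx, hqy⟩ := exists_pos_scale (x := (Q + 1) * (2 * (b₂ / 4 * C)))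
    (y := V⁻¹ * 2 ^ d) (by positivity) (by positivity) hB
  refine ⟨(b₂ / 4 * q) ^ 2 / 4, by positivity, fun n m hn hm => ?_⟩
  set T : ℝ := (n : ℝ) * m with hT
  have hT1 : 1 ≤ T := one_le_mul_of_one_le_of_one_le (by exact_mod_cast hn) (by exact_mod_cast hm)
  set S := ∑ i, (s i)⁻¹ with hS
  have hS0 : 0 ≤ S := Finset.sum_nonneg fun i _ => (inv_pos.2 (hs i)).le
  -- Solves the balance `T * ρ ^ (S + 2) = 1` between cell mass and squared bias.
  set ρ : ℝ := T ^ (-(1 / (2 + S))) with hρ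
  have hρ0 : 0 < ρ := Real.rpow_pos_of_pos (by linarith) _
  have hρ1 : ρ ≤ 1 := Real.rpow_le_one_of_one_le_of_nonpos hT1 (by
    have : 0 ≤ 1 / (2 + S) := by positivity
    linarith)
  have hρ2 : ρ ^ 2 = T ^ (-(2 / (2 + S))) := by
    rw [hρ, ← Real.rpow_natCast, ← Real.rpow_mul (by linarith)]
    congr 1
    push_cast
    ring
  have hρS : T * (ρ ^ S * ρ ^ 2) = 1 := by
    rw [← Real.rpow_natCast ρ 2, ← Real.rpow_add hρ0, hρ, ← Real.rpow_mul (by linarith)]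
    have : -(1 / (2 + S)) * (S + (2 : ℕ)) = -1 := by
      push_cast
      field_simp
      ring
    rw [this, Real.rpow_neg_one, mul_inv_cancel₀ (by linarith)]
  -- The finest grid with `ρ * N i ^ s i ≤ 1`.
  set N : Fin d → ℕ := fun i => ⌊ρ ^ (-(s i)⁻¹)⌋₊ with hNdef
  have hpow1 : ∀ i, 1 ≤ ρ ^ (-(s i)⁻¹) := fun i =>
    Real.one_le_rpow_of_pos_of_le_one_of_nonpos hρ0 hρ1 (by
      have := inv_pos.2 (hs i)
      linarith)
  have hN : ∀ i, 1 ≤ N i := fun i => Nat.le_floor (by exact_mod_cast hpow1 i)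
  have hN1 : ∀ i, (1 : ℝ) ≤ N i := fun i => by exact_mod_cast hN i
  have hNle : ∀ i, (N i : ℝ) ≤ ρ ^ (-(s i)⁻¹) := fun i => Nat.floor_le (by linarith [hpow1 i])
  have hNs : ∀ i, ρ * (N i : ℝ) ^ s i ≤ 1 := by
    intro i
    have h1 := Real.rpow_le_rpow (by linarith [hN1 i]) (hNle i) (hs i).le
    rw [← Real.rpow_mul hρ0.le, neg_mul, inv_mul_cancel₀ (hs i).ne', Real.rpow_neg_one] at h1
    calc ρ * (N i : ℝ) ^ s i ≤ ρ * ρ⁻¹ := mul_le_mul_of_nonneg_left h1 hρ0.le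
      _ = 1 := mul_inv_cancel₀ hρ0.ne'
  -- As `N i ≥ 1`, the floor loses at most a factor 2 per direction, whence the `2 ^ d` in the
  -- choice of `q`.
  have hNinv : ∀ i, (N i : ℝ)⁻¹ ≤ 2 * ρ ^ (s i)⁻¹ := by
    intro i
    have h1 : ρ ^ (-(s i)⁻¹) < N i + 1 := Nat.lt_floor_add_one _
    have h2 : ρ ^ (-(s i)⁻¹) * ρ ^ (s i)⁻¹ = 1 := by
      rw [← Real.rpow_add hρ0, neg_add_cancel, Real.rpow_zero]
    have h3 : 0 < ρ ^ (s i)⁻¹ := Real.rpow_pos_of_pos hρ0 _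
    rw [inv_le_iff_one_le_mul₀ (by linarith [hN1 i])]
    nlinarith [hN1 i]
  have hprod : ∏ i, (N i : ℝ)⁻¹ ≤ 2 ^ d * ρ ^ S := by
    refine (Finset.prod_le_prod (fun i _ => by positivity) fun i _ => hNinv i).trans (le_of_eq ?_)
    rw [Finset.prod_mul_distrib, ← Real.rpow_sum_of_pos hρ0]
    simp [hS]
  have hmain := le_minimaxPredictionError_of_signModel (n := n) (m := m) (D := D)
    (PX := uniformLaw D) (s := s) (B := B) (b₂ := b₂) (b₃ := b₃) (ε := q * ρ)
    (φ := boxBump N w) hb₂ (by positivity) (mul_le_one₀ hq1 hρ0.le hρ1)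
    (continuous_boxBump hw.continuous) ?_ ?_ ?_ ?_
  · refine le_trans ?_ hmain
    have hhalf : (1 / 2 : ℝ≥0∞) = ENNReal.ofReal (1 / 2) := by
      rw [ENNReal.ofReal_div_of_pos (by norm_num)]
      simp
    calc ENNReal.ofReal ((b₂ / 4 * q) ^ 2 / 4 * T ^ (-(2 / (2 + S))))
        = ENNReal.ofReal ((b₂ / 4 * (q * ρ)) ^ 2) * (1 / 2) * (1 / 2) := by
          rw [hhalf, ← ENNReal.ofReal_mul (by positivity), ← ENNReal.ofReal_mul (by positivity),
            ← hρ2]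
          congr 1
          ring
      _ ≤ _ := by
        gcongr
        exact half_le_sum_lintegral_boxBump_sq hD hD_pos hd hN hw.continuous hwp
  · have h := pairwiseDisjointSupport_boxBumpDeriv (N := N) hw0 ⟨0, hd⟩ 0
    intro x k l hk hl
    refine h x k l ?_ ?_ <;> rwa [boxBumpDeriv_zero]
  · intro k x
    unfold boxBump
    rw [Finset.abs_prod]
    exact Finset.prod_le_one (fun _ _ => abs_nonneg _) fun _ _ => hw1 _
  · intro k
    right
    have hw0' : ∀ t, t ∉ Set.Ioo (0 : ℝ) 1 → w t = 0 := fun t ht => by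
      simpa using hw0 0 t ht
    have hVinv : (volume D)⁻¹ = ENNReal.ofReal V⁻¹ := by
      rw [ENNReal.ofReal_inv_of_pos hV0, ENNReal.ofReal_toReal hfin]
    calc (n : ℝ≥0∞) * m * uniformLaw D {x | boxBump N w k x ≠ 0} * ENNReal.ofReal ((q * ρ) ^ 2)
        ≤ n * m * ((volume D)⁻¹ * ENNReal.ofReal (2 ^ d * ρ ^ S)) *
          ENNReal.ofReal ((q * ρ) ^ 2) := by
          gcongr
          exact (uniformLaw_boxBump_ne_zero_le hN hw0' k).trans (by gcongr)
      _ = ENNReal.ofReal (T * (V⁻¹ * (2 ^ d * ρ ^ S)) * (q * ρ) ^ 2) := by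
        rw [hVinv, ← ENNReal.ofReal_natCast n, ← ENNReal.ofReal_natCast m,
          ← ENNReal.ofReal_mul (by positivity), ← ENNReal.ofReal_mul (by positivity),
          ← ENNReal.ofReal_mul (by positivity), ← ENNReal.ofReal_mul (by positivity)]
      _ ≤ ENNReal.ofReal (1 / 2) := by
        refine ENNReal.ofReal_le_ofReal ?_
        calc T * (V⁻¹ * (2 ^ d * ρ ^ S)) * (q * ρ) ^ 2
            = q * (q * (V⁻¹ * 2 ^ d)) * (T * (ρ ^ S * ρ ^ 2)) := by ring
          _ ≤ 1 / 2 := by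
            rw [hρS, mul_one]
            exact (mul_le_of_le_one_left (by positivity) hq1).trans hqy
      _ = 1 / 2 := by
        rw [ENNReal.ofReal_div_of_pos (by norm_num)]
        simp
  · intro v
    refine (anisoHolderNorm_signedSum_boxBump_le D hs hN hw hw1 hw0 hKC (b := b₂ / 4 * q) hC0.le
      (by positivity) (fun i => ?_) v).trans ?_
    · calc b₂ / 4 * (q * ρ) * (N i : ℝ) ^ s i = b₂ / 4 * q * (ρ * (N i : ℝ) ^ s i) := by ring
        _ ≤ b₂ / 4 * q := mul_le_of_le_one_right (by positivity) (hNs i)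
    · rw [← hQ, ← ENNReal.ofReal_natCast, ← ENNReal.ofReal_mul (by positivity)]
      refine ENNReal.ofReal_le_ofReal (le_trans ?_ hqx)
      have : 0 < q * (2 * (b₂ / 4 * C)) := by positivity
      nlinarith

end Rates

theorem theorem9 (d : ℕ) (hd : 2 ≤ d) (D : Set (Fin d → ℝ)) (hD : MeasurableSet D)
    (hD_cube : D ⊆ Set.Icc 0 1) (hD_pos : volume D ≠ 0)
    (s : Fin d → ℝ) (hs : ∀ i, 0 < s i)
    (B b₂ b₃ : ℝ) (hB : 0 < B) (hb₂ : 0 < b₂) (hb₃ : 0 ≤ b₃) :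
    ∃ c : ℝ, 0 < c ∧ ∀ n m : ℕ, 1 ≤ n → 1 ≤ m →
      ENNReal.ofReal (c * ((n : ℝ)⁻¹ +
          ((n : ℝ) * (m : ℝ)) ^ (-(2 * harmonicMean s) / (2 * harmonicMean s + (d : ℝ))))) ≤
        minimaxPredictionError n m D (uniformLaw D) s B b₂ b₃ := by
  have hd0 : 0 < d := by omega
  have hd' : (0 : ℝ) < d := by exact_mod_cast hd0
  have hprob := isProbabilityMeasure_uniformLaw hD_cube hD_pos
  obtain ⟨c₁, hc₁, h₁⟩ := exists_parametric_lower_bound (D := D) (PX := uniformLaw D) (s := s)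
    (b₃ := b₃) hB hb₂
  obtain ⟨c₂, hc₂, h₂⟩ := exists_nonparametric_lower_bound (b₃ := b₃) hd0 hD_cube hD_pos
    hs hB hb₂
  refine ⟨min c₁ c₂ / 2, by positivity, fun n m hn hm => ?_⟩
  have hS : 0 < ∑ i, (s i)⁻¹ := by
    have : Nonempty (Fin d) := ⟨⟨0, hd0⟩⟩
    exact Finset.sum_pos (fun i _ => inv_pos.2 (hs i)) Finset.univ_nonempty
  -- Insert `s̃ = d / S` with `S = ∑ 1/s_i` and cancel `d / S`.
  have hexp : -(2 * harmonicMean s) / (2 * harmonicMean s + (d : ℝ)) =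
      -(2 / (2 + ∑ i, (s i)⁻¹)) := by
    unfold harmonicMean
    generalize ∑ i, (s i)⁻¹ = S at hS
    field_simp
  rw [hexp]
  set y := ((n : ℝ) * m) ^ (-(2 / (2 + ∑ i, (s i)⁻¹))) with hy
  have hy0 : 0 ≤ y := by positivity
  have hn0 : 0 ≤ (n : ℝ)⁻¹ := by positivity
  have e1 : min c₁ c₂ * (n : ℝ)⁻¹ ≤ c₁ * (n : ℝ)⁻¹ :=
    mul_le_mul_of_nonneg_right (min_le_left _ _) hn0
  have e2 : min c₁ c₂ * y ≤ c₂ * y := mul_le_mul_of_nonneg_right (min_le_right _ _) hy0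
  -- The halved sum is at most the larger of the two lower bounds.
  rcases le_total (c₁ * (n : ℝ)⁻¹) (c₂ * y) with h | h
  · refine (ENNReal.ofReal_le_ofReal ?_).trans (h₂ n m hn hm)
    linarith
  · refine (ENNReal.ofReal_le_ofReal ?_).trans (h₁ n m hn)
    linarith
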